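/- Let $1\le N\le N_t$ and $P_T,\sigma^2>0$, and put $\rho=P_T/\sigma^2$. Let $\mathbf h\in\mathbb C^{N_t}$ be a random vector with i.i.d. $\mathcal{CN}(0,1)$ entries, and let $\mathbf P=[\mathbf p_1,\dots,\mathbf p_N]\in\mathbb C^{N_t\times N}$ be a random matrix, independent of $\mathbf h$, with orthonormal columns (almost surely). Let $$\mathrm{SINR}_n=\frac{|\mathbf h^T\mathbf p_n|^2\,P_T/N}{\sigma^2+\sum_{i\ne n}|\mathbf h^T\mathbf p_i|^2\,P_T/N},\qquad X_{\max}=\max_{1\le n\le N}\mathrm{SINR}_n .$$ Then $X_{\max}$ is a random variable, and its cumulative distribution function $F$ satisfies the following. (i) If $x\ge 1$, then $F(x)=1-\dfrac{N}{(x+1)^{N-1}}\,e^{-xN/\rho}$. (ii) If $N\ge 2$, $0<x<1$ and $m=\lceil 1/x\rceil$, then $F(x)=1-\Big(\mathcal P_1+\sum_{k=2}^{m-1}\mathcal P_k+\mathcal P_m\Big)$, where, with $b_k=\dfrac{xN}{\rho(1/k-x)}$ and, for an expression $g(i,l)$, $$\xi_p\big(g\big)=\frac{N}{(N-2)!}\sum_{t=1}^{p}\binom{N-1}{t-1}(-1)^{t+1}\sum_{i=0}^{N-2}\binom{N-2}{i}(1-t)^i\,i!\sum_{l=0}^{i}g(i,l)$$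 (with $0^0=1$, and $\binom{N-1}{t-1}=0$ for $t>N$), $$\mathcal P_1=\frac{N}{(N-2)!}\big(e^{-xN/\rho}C_1+C_2\big),$$ $$\mathcal P_k=\xi_k\Big(e^{-xN/\rho}\frac{x^l}{l!}D_1-\frac{1}{(k-1)^l\,l!}D_2\Big)+\xi_k\Big(\frac{1}{k^l\,l!}E_1-\frac{1}{(k-1)^l\,l!}E_2\Big)\qquad(2\le k\le m-1),$$ $$\mathcal P_m=\xi_m\Big(e^{-xN/\rho}\frac{x^l}{l!}F_1-\frac{1}{(m-1)^l\,l!}F_2\Big),$$ and $$C_1=\frac{(N-2)!}{(x+1)^{N-1}}\Big(1-e^{-(x+1)b_1}\sum_{l=0}^{N-2}\frac{(x+1)^l b_1^l}{l!}\Big),\qquad C_2=\frac{(N-2)!}{2^{N-1}}e^{-2b_1}\sum_{l=0}^{N-2}\frac{2^l b_1^l}{l!},$$ $$D_1=\sum_{v=0}^{l}\binom lv\Big(\frac N\rho\Big)^{l-v}\frac{(N-i+v-2)!}{(x+1)^{N-i+v-1}}\sum_{u=0}^{N-i+v-2}\frac{(x+1)^u}{u!}\Big(e^{-(x+1)b_{k-1}}b_{k-1}^u-e^{-(x+1)b_k}b_k^u\Big),$$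 $$D_2=\frac{(N-i+l-2)!}{\left(\frac{k}{k-1}\right)^{N-i+l-1}}\bigg[e^{-\frac{k}{k-1}b_{k-1}}\sum_{u=0}^{N-i+l-2}\Big(\frac{k}{k-1}\Big)^u\frac{b_{k-1}^u}{u!}-e^{-\frac{k}{k-1}b_k}\sum_{u=0}^{N-i+l-2}\Big(\frac{k}{k-1}\Big)^u\frac{b_k^u}{u!}\bigg],$$ $$E_1=\frac{(N-i+l-2)!}{\left(\frac{k+1}{k}\right)^{N-i+l-1}}e^{-\frac{k+1}{k}b_k}\sum_{u=0}^{N-i+l-2}\Big(\frac{k+1}{k}\Big)^u\frac{b_k^u}{u!},\qquad E_2=\frac{(N-i+l-2)!}{\left(\frac{k}{k-1}\right)^{N-i+l-1}}e^{-\frac{k}{k-1}b_k}\sum_{u=0}^{N-i+l-2}\Big(\frac{k}{k-1}\Big)^u\frac{b_k^u}{u!},$$ $$F_1=\sum_{v=0}^{l}\binom lv\Big(\frac N\rho\Big)^{l-v}\frac{(N-i+v-2)!}{(x+1)^{N-i+v-1}}e^{-(x+1)b_{m-1}}\sum_{u=0}^{N-i+v-2}(x+1)^u\frac{b_{m-1}^u}{u!},$$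 $$F_2=\frac{(N-i+l-2)!}{\left(\frac{m}{m-1}\right)^{N-i+l-1}}e^{-\frac{m}{m-1}b_{m-1}}\sum_{u=0}^{N-i+l-2}\Big(\frac{m}{m-1}\Big)^u\frac{b_{m-1}^u}{u!}.$$ -/

import Mathlib

open MeasureTheory ProbabilityTheory

namespace ORP

noncomputable section

/-- The circularly symmetric complex Gaussian law `CN(0, v)`: the real and imaginary parts are
independent centred real Gaussians, each of variance `v / 2`. -/
def complexGaussian (v : NNReal) : Measure ℂ :=
  ((gaussianReal 0 (v / 2)).prod (gaussianReal 0 (v / 2))).map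
    (fun p : ℝ × ℝ => (⟨p.1, p.2⟩ : ℂ))

/-- The gain `|hᵀ pₙ|²` of the `n`-th beam, `pₙ` being the `n`-th column of `P`. -/
def beamGain {Nt N : ℕ} (h : Fin Nt → ℂ) (P : Matrix (Fin Nt) (Fin N) ℂ) (n : Fin N) : ℝ :=
  ‖∑ j, h j * P j n‖ ^ 2

/-- The signal-to-interference-plus-noise ratio of the `n`-th beam, with total transmit power `PT`
split equally among the `N` beams and noise variance `σ2`. -/
def sinr {Nt N : ℕ} (PT σ2 : ℝ) (h : Fin Nt → ℂ) (P : Matrix (Fin Nt) (Fin N) ℂ)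
    (n : Fin N) : ℝ :=
  beamGain h P n * (PT / N) /
    (σ2 + ∑ i ∈ Finset.univ.erase n, beamGain h P i * (PT / N))

/-- The maximum of the `N` ratios (used for `N ≥ 1`). -/
def maxSINR {Nt N : ℕ} (PT σ2 : ℝ) (h : Fin Nt → ℂ) (P : Matrix (Fin Nt) (Fin N) ℂ) : ℝ :=
  ⨆ n : Fin N, sinr PT σ2 h P n

/-! ### The closed-form terms

They are used for `N ≥ 2` and `0 < T < 1`; then `i ≤ N - 2`, so that no natural-number subtraction
below truncates. -/

/-- `b_k = T N / (ρ (1/k - T))`. -/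
def bPt (N : ℕ) (ρ T : ℝ) (k : ℕ) : ℝ :=
  T * N / (ρ * (1 / (k : ℝ) - T))

/-- The operator `ξ_p`, applied to an expression in the summation indices `i` and `l`. -/
def xi (N p : ℕ) (f : ℕ → ℕ → ℝ) : ℝ :=
  (N : ℝ) / ((N - 2).factorial : ℝ) *
    ∑ t ∈ Finset.Icc 1 p, ((N - 1).choose (t - 1) : ℝ) * (-1) ^ (t + 1) *
      ∑ i ∈ Finset.range (N - 1), ((N - 2).choose i : ℝ) * (1 - (t : ℝ)) ^ i * (i.factorial : ℝ) *
        ∑ l ∈ Finset.range (i + 1), f i l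

def C1 (N : ℕ) (ρ T : ℝ) : ℝ :=
  ((N - 2).factorial : ℝ) / (T + 1) ^ (N - 1) *
    (1 - Real.exp (-((T + 1) * bPt N ρ T 1)) *
      ∑ l ∈ Finset.range (N - 1), (T + 1) ^ l * bPt N ρ T 1 ^ l / (l.factorial : ℝ))

def C2 (N : ℕ) (ρ T : ℝ) : ℝ :=
  ((N - 2).factorial : ℝ) / 2 ^ (N - 1) * Real.exp (-(2 * bPt N ρ T 1)) *
    ∑ l ∈ Finset.range (N - 1), 2 ^ l * bPt N ρ T 1 ^ l / (l.factorial : ℝ)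

def D1 (N : ℕ) (ρ T : ℝ) (k i l : ℕ) : ℝ :=
  ∑ v ∈ Finset.range (l + 1), (l.choose v : ℝ) * ((N : ℝ) / ρ) ^ (l - v) *
    (((N - i + v - 2).factorial : ℝ) / (T + 1) ^ (N - i + v - 1)) *
      ∑ u ∈ Finset.range (N - i + v - 1), (T + 1) ^ u / (u.factorial : ℝ) *
        (Real.exp (-((T + 1) * bPt N ρ T (k - 1))) * bPt N ρ T (k - 1) ^ u -
          Real.exp (-((T + 1) * bPt N ρ T k)) * bPt N ρ T k ^ u)

def D2 (N : ℕ) (ρ T : ℝ) (k i l : ℕ) : ℝ :=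
  ((N - i + l - 2).factorial : ℝ) / ((k : ℝ) / ((k : ℝ) - 1)) ^ (N - i + l - 1) *
    (Real.exp (-((k : ℝ) / ((k : ℝ) - 1) * bPt N ρ T (k - 1))) *
        ∑ u ∈ Finset.range (N - i + l - 1),
          ((k : ℝ) / ((k : ℝ) - 1)) ^ u * (bPt N ρ T (k - 1) ^ u / (u.factorial : ℝ)) -
      Real.exp (-((k : ℝ) / ((k : ℝ) - 1) * bPt N ρ T k)) *
        ∑ u ∈ Finset.range (N - i + l - 1),
          ((k : ℝ) / ((k : ℝ) - 1)) ^ u * (bPt N ρ T k ^ u / (u.factorial : ℝ)))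

def E1 (N : ℕ) (ρ T : ℝ) (k i l : ℕ) : ℝ :=
  ((N - i + l - 2).factorial : ℝ) / (((k : ℝ) + 1) / (k : ℝ)) ^ (N - i + l - 1) *
    Real.exp (-(((k : ℝ) + 1) / (k : ℝ) * bPt N ρ T k)) *
      ∑ u ∈ Finset.range (N - i + l - 1),
        (((k : ℝ) + 1) / (k : ℝ)) ^ u * (bPt N ρ T k ^ u / (u.factorial : ℝ))

def E2 (N : ℕ) (ρ T : ℝ) (k i l : ℕ) : ℝ :=
  ((N - i + l - 2).factorial : ℝ) / ((k : ℝ) / ((k : ℝ) - 1)) ^ (N - i + l - 1) *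
    Real.exp (-((k : ℝ) / ((k : ℝ) - 1) * bPt N ρ T k)) *
      ∑ u ∈ Finset.range (N - i + l - 1),
        ((k : ℝ) / ((k : ℝ) - 1)) ^ u * (bPt N ρ T k ^ u / (u.factorial : ℝ))

def F1 (N : ℕ) (ρ T : ℝ) (m i l : ℕ) : ℝ :=
  ∑ v ∈ Finset.range (l + 1), (l.choose v : ℝ) * ((N : ℝ) / ρ) ^ (l - v) *
    (((N - i + v - 2).factorial : ℝ) / (T + 1) ^ (N - i + v - 1)) *
      Real.exp (-((T + 1) * bPt N ρ T (m - 1))) *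
        ∑ u ∈ Finset.range (N - i + v - 1),
          (T + 1) ^ u * (bPt N ρ T (m - 1) ^ u / (u.factorial : ℝ))

def F2 (N : ℕ) (ρ T : ℝ) (m i l : ℕ) : ℝ :=
  ((N - i + l - 2).factorial : ℝ) / ((m : ℝ) / ((m : ℝ) - 1)) ^ (N - i + l - 1) *
    Real.exp (-((m : ℝ) / ((m : ℝ) - 1) * bPt N ρ T (m - 1))) *
      ∑ u ∈ Finset.range (N - i + l - 1),
        ((m : ℝ) / ((m : ℝ) - 1)) ^ u * (bPt N ρ T (m - 1) ^ u / (u.factorial : ℝ))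

/-- The first term of the coverage probability for `0 < T < 1`. -/
def covFirst (N : ℕ) (ρ T : ℝ) : ℝ :=
  (N : ℝ) / ((N - 2).factorial : ℝ) *
    (Real.exp (-(T * N / ρ)) * C1 N ρ T + C2 N ρ T)

/-- The `k`-th term of the coverage probability for `0 < T < 1`, where `2 ≤ k ≤ m - 1`. -/
def covMid (N : ℕ) (ρ T : ℝ) (k : ℕ) : ℝ :=
  xi N k (fun i l =>
      Real.exp (-(T * N / ρ)) * (T ^ l / (l.factorial : ℝ)) * D1 N ρ T k i l -
        1 / (((k : ℝ) - 1) ^ l * (l.factorial : ℝ)) * D2 N ρ T k i l) +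
    xi N k (fun i l =>
      1 / ((k : ℝ) ^ l * (l.factorial : ℝ)) * E1 N ρ T k i l -
        1 / (((k : ℝ) - 1) ^ l * (l.factorial : ℝ)) * E2 N ρ T k i l)

/-- The last term of the coverage probability for `0 < T < 1`. -/
def covLast (N : ℕ) (ρ T : ℝ) (m : ℕ) : ℝ :=
  xi N m (fun i l =>
    Real.exp (-(T * N / ρ)) * (T ^ l / (l.factorial : ℝ)) * F1 N ρ T m i l -
      1 / (((m : ℝ) - 1) ^ l * (l.factorial : ℝ)) * F2 N ρ T m i l)

end

end ORP

namespace ORP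

/-! The law of a vector of i.i.d. `CN(0,1)` entries is unitarily invariant, so for a fixed `P` with
orthonormal columns the entries of `hᵀP` are again i.i.d. `CN(0,1)`, and their squared moduli are
i.i.d. standard exponentials. This law does not depend on `P`, so it persists for a random `P`
independent of `h` (`map_gains`). With `a = N/ρ`, the event `X_max > x` says that some gain
satisfies `g n > x (a + ∑_{i≠n} g i)`.

If `x ≥ 1`, two gains cannot both do this, so the probability is `N` times that of a single
exceedance: an exponential tail averaged through a Laplace transform.

If `x < 1`, exceedances overlap, but one occurs exactly when the largest gain exceeds, and the
largest gain is almost surely unique. By symmetry the probability is `N` times an integral over the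
largest gain `z` and the sum `y` of the others, which are confined to `(0, z]`. On a slice of
constant sum the exponential weight is the constant `e^{-y}`, so the density is `e^{-z} e^{-y}`
times an Irwin–Hall density scaled to side `z` (`lintegral_sum_exp_box`).

That density is polynomial on each wedge `(k-1) z < y ≤ k z`, and `z > x (a + y)` leaves only the
wedges `k ≤ m = ⌈1/x⌉`. At fixed `y`, the wedge restricts `z` to the range from `max (x (a + y))
(y/k)` to `y/(k-1)`; the maximum switches branch at `y = b_k`. Binomial expansion and incomplete
gamma integrals, in `z` and then in `y`, produce the closed-form terms. -/

/-! ### The law of the beam gains -/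

instance isProbabilityMeasure_complexGaussian (v : NNReal) :
    IsProbabilityMeasure (complexGaussian v) :=
  Measure.isProbabilityMeasure_map
    (Complex.measurableEquivRealProd.symm.measurable).aemeasurable

instance isProbabilityMeasure_expMeasure_one : IsProbabilityMeasure (expMeasure 1) :=
  isProbabilityMeasure_expMeasure one_pos

theorem measurable_complex_mk : Measurable (fun p : ℝ × ℝ => (⟨p.1, p.2⟩ : ℂ)) :=
  Complex.measurableEquivRealProd.symm.measurable

/-- Each real component has variance `1/2`, hence the factor `1/4`. Only `‖t‖` enters, which is the
source of unitary invariance. -/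
theorem charFun_complexGaussian (t : ℂ) :
    charFun (complexGaussian 1) t = Complex.exp (-(‖t‖ ^ 2 / 4 : ℝ)) := by
  have key : ∀ p : ℝ × ℝ, Complex.exp ((inner ℝ (⟨p.1, p.2⟩ : ℂ) t : ℝ) * Complex.I) =
      Complex.exp (t.re * p.1 * Complex.I) * Complex.exp (t.im * p.2 * Complex.I) := by
    intro p
    rw [← Complex.exp_add, Complex.inner]
    congr 1
    simp
    ring
  rw [charFun_apply, complexGaussian,
    integral_map measurable_complex_mk.aemeasurable
      (Measurable.aestronglyMeasurable (by fun_prop))]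
  simp_rw [key]
  rw [integral_prod_mul (fun a : ℝ => Complex.exp (t.re * a * Complex.I))
    (fun a : ℝ => Complex.exp (t.im * a * Complex.I)), ← charFun_apply_real, ← charFun_apply_real,
    charFun_gaussianReal, charFun_gaussianReal, ← Complex.exp_add, ← Complex.normSq_eq_norm_sq,
    Complex.normSq_apply]
  congr 1
  push_cast
  ring

theorem sum_norm_sq_conj_mulVec {Nt N : ℕ} {P : Matrix (Fin Nt) (Fin N) ℂ}
    (hP : P.conjTranspose * P = 1) (t : Fin N → ℂ) :
    ∑ j, ‖∑ n, star (P j n) * t n‖ ^ 2 = ∑ n, ‖t n‖ ^ 2 := by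
  have h : ∀ m n, ∑ j, star (P j m) * P j n = if m = n then 1 else 0 := by
    intro m n
    have := congrFun (congrFun hP m) n
    simpa [Matrix.mul_apply, Matrix.one_apply] using this
  have key : ∑ j, (∑ n, star (P j n) * t n) * star (∑ n, star (P j n) * t n) =
      ∑ n, t n * star (t n) := by
    simp_rw [star_sum, star_mul', star_star, Finset.sum_mul_sum]
    rw [Finset.sum_comm]
    refine Finset.sum_congr rfl fun n _ => ?_
    rw [Finset.sum_comm]
    calc ∑ m, ∑ j, star (P j n) * t n * (P j m * star (t m))
        = ∑ m, (∑ j, star (P j n) * P j m) * (t n * star (t m)) := by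
          refine Finset.sum_congr rfl fun m _ => ?_
          rw [Finset.sum_mul]
          exact Finset.sum_congr rfl fun j _ => by ring
      _ = t n * star (t n) := by
          simp_rw [h, ite_mul, one_mul, zero_mul]
          rw [Finset.sum_ite_eq, if_pos (Finset.mem_univ n)]
  have e : ∀ z : ℂ, z * star z = ((‖z‖ ^ 2 : ℝ) : ℂ) := fun z => by
    rw [Complex.star_def, Complex.mul_conj, Complex.normSq_eq_norm_sq]
  simp_rw [e] at key
  exact_mod_cast key

/-- Adjointness for the real inner product: it moves `P` from `h` onto the frequency `t`. -/
theorem sum_re_mul_star {Nt N : ℕ} (P : Fin Nt → Fin N → ℂ) (h : Fin Nt → ℂ) (t : Fin N → ℂ) :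
    ∑ n, ((∑ j, h j * P j n) * star (t n)).re =
      ∑ j, (h j * star (∑ n, star (P j n) * t n)).re := by
  simp_rw [← Complex.re_sum, star_sum, star_mul', star_star, Finset.sum_mul, Finset.mul_sum]
  rw [Finset.sum_comm]
  simp_rw [mul_assoc]

/-- The characteristic function of `hᵀP` at `t` is that of `h` at the image of `t` under the
entrywise conjugate of `P`. It depends only on the norm of that image, and orthonormal columns
preserve the norm. -/
theorem map_pi_complexGaussian {Nt N : ℕ} {P : Matrix (Fin Nt) (Fin N) ℂ}
    (hP : P.conjTranspose * P = 1) :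
    (Measure.pi fun _ : Fin Nt => complexGaussian 1).map (fun h n => ∑ j, h j * P j n) =
      Measure.pi fun _ : Fin N => complexGaussian 1 := by
  have hm : Measurable (fun (h : Fin Nt → ℂ) (n : Fin N) => ∑ j, h j * P j n) := by fun_prop
  have : IsProbabilityMeasure ((Measure.pi fun _ : Fin Nt => complexGaussian 1).map
      (fun h n => ∑ j, h j * P j n)) := Measure.isProbabilityMeasure_map hm.aemeasurable
  refine charFun_eq_pi_iff.1 fun t => ?_
  have h2 := charFun_pi (μ := fun _ : Fin Nt => complexGaussian 1)
    (WithLp.toLp 2 fun j => ∑ n, star (P j n) * t n)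
  simp_rw [charFun_complexGaussian, ← Complex.exp_sum] at h2 ⊢
  have h3 : ∑ j, (-((‖∑ n, star (P j n) * t n‖ ^ 2 / 4 : ℝ) : ℂ)) =
      ∑ n, (-((‖t n‖ ^ 2 / 4 : ℝ) : ℂ)) := by
    rw [Finset.sum_neg_distrib, Finset.sum_neg_distrib, ← Complex.ofReal_sum,
      ← Complex.ofReal_sum, ← Finset.sum_div, ← Finset.sum_div, sum_norm_sq_conj_mulVec hP]
  rw [← h3, ← h2, charFun_apply, charFun_apply, ← MeasurableEquiv.coe_toLp,
    ← MeasurableEquiv.coe_toLp, integral_map_equiv, integral_map_equiv,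
    integral_map hm.aemeasurable (Measurable.aestronglyMeasurable (by fun_prop))]
  congr 1
  funext h
  congr 3
  simp only [MeasurableEquiv.coe_toLp, PiLp.inner_apply, Complex.inner]
  have e' : ∀ a b : ℂ, (b * (starRingEnd ℂ) a).re = (a * star b).re := fun a b => by
    simp only [Complex.mul_re, Complex.conj_re, Complex.conj_im, Complex.star_def]
    ring
  calc _ = _ := Finset.sum_congr rfl fun n _ => e' _ _
    _ = _ := sum_re_mul_star P h t
    _ = _ := (Finset.sum_congr rfl fun j _ => e' _ _).symm

theorem lintegral_expMeasure_one (g : ℝ → ENNReal) (hg : Measurable g) :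
    ∫⁻ x, g x ∂(expMeasure 1) =
      ∫⁻ x in Set.Ioi 0, ENNReal.ofReal (Real.exp (-x)) * g x := by
  have : expMeasure 1 = volume.withDensity (exponentialPDF 1) := rfl
  have hm : Measurable (exponentialPDF 1) :=
    (measurable_exponentialPDFReal 1).ennreal_ofReal
  rw [this, lintegral_withDensity_eq_lintegral_mul _ hm hg, ← lintegral_indicator measurableSet_Ioi]
  -- The exponential density is supported on `0 ≤ x`, the integral on `0 < x`; the point `0` is
  -- null.
  have h0 : ∀ᵐ x : ℝ, x ≠ 0 := by simp [ae_iff]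
  refine lintegral_congr_ae ?_
  filter_upwards [h0] with x hx
  rw [Pi.mul_apply, exponentialPDF_eq]
  rcases lt_or_gt_of_ne hx with h | h
  · simp [Set.indicator, not_le.2 h, not_lt.2 h.le]
  · simp [Set.indicator, h, h.le]

/-- Polar coordinates turn the density `e^{-r²}/π` into `2 r e^{-r²} dr`, which the substitution `s
= r²` makes `e^{-s} ds`. -/
theorem lintegral_complexGaussian_norm_sq (g : ℝ → ENNReal) (hg : Measurable g) :
    ∫⁻ z, g (‖z‖ ^ 2) ∂(complexGaussian 1) = ∫⁻ x, g x ∂(expMeasure 1) := by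
  have hd : ∀ p : ℝ × ℝ, gaussianPDF 0 (1 / 2) p.1 * gaussianPDF 0 (1 / 2) p.2 =
      ENNReal.ofReal (Real.exp (-(p.1 ^ 2 + p.2 ^ 2)) / Real.pi) := by
    intro p
    rw [gaussianPDF, gaussianPDF, ← ENNReal.ofReal_mul (gaussianPDFReal_nonneg _ _ _)]
    congr 1
    rw [gaussianPDFReal, gaussianPDFReal]
    have h1 : 2 * Real.pi * ((1 / 2 : NNReal) : ℝ) = Real.pi := by push_cast; ring
    have h2 : 2 * ((1 / 2 : NNReal) : ℝ) = 1 := by push_cast; ring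
    rw [h1, h2]
    have h3 : (√Real.pi)⁻¹ * (√Real.pi)⁻¹ = Real.pi⁻¹ := by
      rw [← mul_inv, Real.mul_self_sqrt Real.pi_pos.le]
    calc _ = ((√Real.pi)⁻¹ * (√Real.pi)⁻¹) *
          (Real.exp (-(p.1 - 0) ^ 2 / 1) * Real.exp (-(p.2 - 0) ^ 2 / 1)) := by ring
      _ = _ := by
        rw [h3, ← Real.exp_add, div_eq_inv_mul _ Real.pi]
        congr 2
        ring
  have hn : ∀ p : ℝ × ℝ, ‖(⟨p.1, p.2⟩ : ℂ)‖ ^ 2 = p.1 ^ 2 + p.2 ^ 2 := by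
    intro p
    rw [← Complex.normSq_eq_norm_sq, Complex.normSq_mk]
    ring
  rw [complexGaussian, lintegral_map (by fun_prop) measurable_complex_mk]
  simp_rw [hn]
  rw [
    gaussianReal_of_var_ne_zero _ (by simp),
    prod_withDensity (measurable_gaussianPDF _ _) (measurable_gaussianPDF _ _),
    ← Measure.volume_eq_prod, lintegral_withDensity_eq_lintegral_mul _ (by fun_prop) (by fun_prop)]
  simp only [Pi.mul_apply, hd]
  rw [← lintegral_comp_polarCoord_symm]
  have hp : ∀ p : ℝ × ℝ, (polarCoord.symm p).1 ^ 2 + (polarCoord.symm p).2 ^ 2 = p.1 ^ 2 := by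
    intro p
    simp only [polarCoord_symm_apply]
    linear_combination p.1 ^ 2 * Real.sin_sq_add_cos_sq p.2
  simp_rw [hp, smul_eq_mul]
  have ht : polarCoord.target = Set.Ioi (0 : ℝ) ×ˢ Set.Ioo (-Real.pi) Real.pi := rfl
  rw [ht, Measure.volume_eq_prod, ← Measure.prod_restrict, lintegral_prod _ (by fun_prop)]
  simp only [lintegral_const, Measure.restrict_apply MeasurableSet.univ, Set.univ_inter,
    Real.volume_Ioo]
  rw [lintegral_expMeasure_one g hg]
  have himg : (fun r : ℝ => r ^ 2) '' Set.Ioi 0 = Set.Ioi 0 := by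
    ext y
    constructor
    · rintro ⟨r, hr, rfl⟩
      exact pow_pos (Set.mem_Ioi.1 hr) 2
    · intro hy
      exact ⟨√y, Real.sqrt_pos.2 hy, Real.sq_sqrt (le_of_lt hy)⟩
  conv_rhs => rw [← himg]
  rw [lintegral_image_eq_lintegral_abs_deriv_mul measurableSet_Ioi
    (fun r _ => (hasDerivAt_pow 2 r).hasDerivWithinAt)
    (fun a ha b hb hab => (pow_left_inj₀ (le_of_lt ha) (le_of_lt hb) two_ne_zero).1 hab)]
  refine setLIntegral_congr_fun measurableSet_Ioi fun r hr => ?_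
  have hr0 : (0 : ℝ) < r := hr
  rw [mul_right_comm, ← mul_assoc, mul_right_comm (ENNReal.ofReal r), ← mul_assoc,
    ← ENNReal.ofReal_mul hr0.le, ← ENNReal.ofReal_mul (by positivity),
    ← ENNReal.ofReal_mul (by positivity)]
  congr 2
  simp only [Nat.cast_ofNat, Nat.add_one_sub_one, pow_one]
  rw [abs_of_pos (by positivity)]
  field_simp
  ring

theorem map_norm_sq_complexGaussian :
    (complexGaussian 1).map (fun z => ‖z‖ ^ 2) = expMeasure 1 := by
  refine Measure.ext_of_lintegral _ fun f hf => ?_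
  rw [lintegral_map hf (by fun_prop), lintegral_complexGaussian_norm_sq f hf]

theorem map_beamGain {Nt N : ℕ} {P : Matrix (Fin Nt) (Fin N) ℂ}
    (hP : P.conjTranspose * P = 1) :
    (Measure.pi fun _ : Fin Nt => complexGaussian 1).map (fun h n => beamGain h P n) =
      Measure.pi fun _ : Fin N => expMeasure 1 := by
  have h1 : (fun (h : Fin Nt → ℂ) (n : Fin N) => beamGain h P n) =
      (fun (z : Fin N → ℂ) n => ‖z n‖ ^ 2) ∘ (fun h n => ∑ j, h j * P j n) := rfl
  rw [h1, ← Measure.map_map (by fun_prop) (by fun_prop), map_pi_complexGaussian hP,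
    Measure.pi_map_pi (f := fun (_ : Fin N) (z : ℂ) => ‖z‖ ^ 2)
      (hμ := by rw [map_norm_sq_complexGaussian]; infer_instance) (fun _ => by fun_prop)]
  simp_rw [map_norm_sq_complexGaussian]

theorem measurable_beamGain {Nt N : ℕ} :
    Measurable (fun q : (Fin Nt → ℂ) × (Fin Nt → Fin N → ℂ) =>
      fun n => ‖∑ j, q.1 j * q.2 j n‖ ^ 2) := by
  fun_prop

theorem aemeasurable_gains {Ω : Type*} [MeasurableSpace Ω] {μ : Measure Ω} {Nt N : ℕ}
    {h : Ω → Fin Nt → ℂ} (hh : AEMeasurable h μ)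
    {P : Ω → Matrix (Fin Nt) (Fin N) ℂ} (P_meas : ∀ j n, AEMeasurable (fun ω => P ω j n) μ) :
    AEMeasurable (fun ω n => beamGain (h ω) (P ω) n) μ := by
  have hP : AEMeasurable (fun ω j n => P ω j n) μ :=
    aemeasurable_pi_lambda _ fun j => aemeasurable_pi_lambda _ fun n => P_meas j n
  have := measurable_beamGain.comp_aemeasurable (hh.prodMk hP)
  exact this

/-- Independence makes the joint law of `(h, P)` a product, so it can be sliced at fixed `p`. Almost
every slice has the same measure, and integrating it over `p` changes nothing. -/
theorem map_gains {Ω : Type*} [MeasurableSpace Ω] {μ : Measure Ω} [IsProbabilityMeasure μ]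
    {Nt N : ℕ} {h : Ω → Fin Nt → ℂ}
    (h_law : ∀ j, HasLaw (fun ω => h ω j) (complexGaussian 1) μ)
    (h_indep : iIndepFun (fun j ω => h ω j) μ)
    {P : Ω → Matrix (Fin Nt) (Fin N) ℂ}
    (P_meas : ∀ j n, AEMeasurable (fun ω => P ω j n) μ)
    (P_orth : ∀ᵐ ω ∂μ, (P ω).conjTranspose * P ω = 1)
    (hP_indep : IndepFun h (fun ω j n => P ω j n) μ) :
    μ.map (fun ω n => beamGain (h ω) (P ω) n) = Measure.pi fun _ : Fin N => expMeasure 1 := by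
  have hh : AEMeasurable h μ := aemeasurable_pi_lambda _ fun j => (h_law j).aemeasurable
  have hP : AEMeasurable (fun ω j n => P ω j n) μ :=
    aemeasurable_pi_lambda _ fun j => aemeasurable_pi_lambda _ fun n => P_meas j n
  have hlaw : μ.map h = Measure.pi fun _ : Fin Nt => complexGaussian 1 := by
    have := (iIndepFun_iff_map_fun_eq_pi_map fun j => (h_law j).aemeasurable).1 h_indep
    simp_rw [(h_law _).map_eq] at this
    exact this
  have hpair := (indepFun_iff_map_prod_eq_prod_map_map hh hP).1 hP_indep
  have horth : ∀ᵐ p ∂(μ.map (fun ω j n => P ω j n)),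
      (fun m n => ∑ j, star (p j m) * p j n) = fun m n => (1 : Matrix (Fin N) (Fin N) ℂ) m n := by
    rw [ae_map_iff hP]
    · filter_upwards [P_orth] with ω hω
      funext m n
      rw [← hω, Matrix.mul_apply]
      rfl
    · exact measurableSet_eq_fun (by fun_prop) measurable_const
  have hPM : IsProbabilityMeasure (μ.map (fun ω j n => P ω j n)) :=
    Measure.isProbabilityMeasure_map hP
  refine Measure.ext fun s hs => ?_
  have h1 : μ.map (fun ω n => beamGain (h ω) (P ω) n) =
      (μ.map (fun ω => (h ω, fun j n => P ω j n))).map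
        (fun q => fun n => ‖∑ j, q.1 j * q.2 j n‖ ^ 2) :=
    (AEMeasurable.map_map_of_aemeasurable measurable_beamGain.aemeasurable (hh.prodMk hP)).symm
  rw [h1, hpair, hlaw, Measure.map_apply measurable_beamGain hs,
    Measure.prod_apply_symm (measurable_beamGain hs)]
  have h2 : ∀ᵐ p ∂(μ.map (fun ω j n => P ω j n)),
      (Measure.pi fun _ : Fin Nt => complexGaussian 1) ((fun x => (x, p)) ⁻¹'
        ((fun q : (Fin Nt → ℂ) × (Fin Nt → Fin N → ℂ) =>
          fun n => ‖∑ j, q.1 j * q.2 j n‖ ^ 2) ⁻¹' s)) =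
      (Measure.pi fun _ : Fin N => expMeasure 1) s := by
    filter_upwards [horth] with p hp
    have hp' : (Matrix.of p).conjTranspose * Matrix.of p = 1 := by
      ext m n
      rw [Matrix.mul_apply]
      exact congrFun (congrFun hp m) n
    rw [← map_beamGain hp', Measure.map_apply _ hs]
    · rfl
    · simp only [beamGain, Matrix.of_apply]
      fun_prop
  rw [lintegral_congr_ae h2, lintegral_const, measure_univ, mul_one]

/-! ### Sums of exponentials confined to a box -/

/-- The truncated power `u₊ ^ n`, equal to the indicator of `u > 0` when `n = 0`. -/
noncomputable def truncPow (n : ℕ) (u : ℝ) : ℝ := if 0 < u then u ^ n else 0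

theorem measurable_truncPow (n : ℕ) : Measurable (truncPow n) :=
  Measurable.ite measurableSet_Ioi (by fun_prop) measurable_const

theorem truncPow_nonneg (n : ℕ) (u : ℝ) : 0 ≤ truncPow n u := by
  unfold truncPow
  split_ifs with h
  · positivity
  · exact le_rfl

theorem truncPow_of_nonpos (n : ℕ) {u : ℝ} (h : u ≤ 0) : truncPow n u = 0 := if_neg h.not_gt

theorem monotone_truncPow (n : ℕ) : Monotone (truncPow n) := by
  intro u v h
  by_cases hu : 0 < u
  · have hv := hu.trans_le h
    rw [truncPow, truncPow, if_pos hu, if_pos hv]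
    gcongr
  · rw [truncPow, if_neg hu]
    exact truncPow_nonneg n v

theorem intervalIntegrable_truncPow (n : ℕ) (a b : ℝ) :
    IntervalIntegrable (truncPow n) volume a b :=
  (monotone_truncPow n).intervalIntegrable

theorem integral_truncPow_zero (n : ℕ) (b : ℝ) :
    ∫ u in (0 : ℝ)..b, truncPow n u = truncPow (n + 1) b / (n + 1) := by
  rcases le_or_gt b 0 with hb | hb
  · rw [truncPow_of_nonpos _ hb, intervalIntegral.integral_congr (g := fun _ => 0)]
    · simp
    · intro u hu
      rw [Set.uIcc_of_ge hb] at hu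
      exact truncPow_of_nonpos n hu.2
  · rw [truncPow, if_pos hb, intervalIntegral.integral_congr_ae (g := fun u => u ^ n)]
    · simp [integral_pow]
    · refine Filter.Eventually.of_forall fun u hu => ?_
      rw [Set.uIoc_of_le hb.le] at hu
      exact if_pos hu.1

theorem integral_truncPow_sub (n : ℕ) (c z : ℝ) :
    ∫ w in (0 : ℝ)..z, truncPow n (c - w) =
      (truncPow (n + 1) c - truncPow (n + 1) (c - z)) / (n + 1) := by
  rw [intervalIntegral.integral_comp_sub_left (truncPow n) c, sub_zero,
    ← intervalIntegral.integral_interval_sub_left (intervalIntegrable_truncPow n 0 c)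
      (intervalIntegrable_truncPow n 0 (c - z)), integral_truncPow_zero, integral_truncPow_zero,
    sub_div]

/-- The volume density at `y` of the sum of `n + 1` coordinates ranging over `(0, z]`. -/
noncomputable def boxDensity (n : ℕ) (z y : ℝ) : ℝ :=
  1 / (n.factorial : ℝ) * ∑ j ∈ Finset.range (n + 2),
    (-1) ^ j * ((n + 1).choose j : ℝ) * truncPow n (y - j * z)

theorem measurable_boxDensity (n : ℕ) : Measurable (fun p : ℝ × ℝ => boxDensity n p.1 p.2) := by
  unfold boxDensity
  refine measurable_const.mul (Finset.measurable_fun_sum _ fun j _ => measurable_const.mul ?_)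
  exact (measurable_truncPow n).comp (by fun_prop)

/-- Pascal's rule, in the form needed when convolution with an interval replaces each term by a
difference of consecutive shifts. -/
theorem sum_choose_sub_shift (n : ℕ) (p : ℕ → ℝ) :
    ∑ j ∈ Finset.range (n + 2), (-1) ^ j * ((n + 1).choose j : ℝ) * (p j - p (j + 1)) =
      ∑ j ∈ Finset.range (n + 3), (-1) ^ j * ((n + 2).choose j : ℝ) * p j := by
  rw [Finset.sum_range_succ' _ (n + 2)]
  have h : ∀ j ∈ Finset.range (n + 2),
      (-1) ^ (j + 1) * ((n + 2).choose (j + 1) : ℝ) * p (j + 1) =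
      (-1) ^ (j + 1) * ((n + 1).choose (j + 1) : ℝ) * p (j + 1) -
        (-1) ^ j * ((n + 1).choose j : ℝ) * p (j + 1) := by
    intro j _
    rw [Nat.choose_succ_succ' (n + 1) j]
    push_cast
    ring
  rw [Finset.sum_congr rfl h, Finset.sum_sub_distrib]
  simp_rw [mul_sub]
  rw [Finset.sum_sub_distrib]
  have h2 := Finset.sum_range_succ' (fun j => (-1) ^ j * ((n + 1).choose j : ℝ) * p j) (n + 2)
  rw [Finset.sum_range_succ] at h2
  simp only [Nat.choose_eq_zero_of_lt (Nat.lt_succ_self (n + 1)), Nat.cast_zero, mul_zero,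
    zero_mul, add_zero, Nat.choose_zero_right] at h2 ⊢
  linarith

theorem intervalIntegrable_truncPow_sub (n : ℕ) (c a b : ℝ) :
    IntervalIntegrable (fun w => truncPow n (c - w)) volume a b := by
  have h : Antitone fun w => truncPow n (c - w) := fun u v huv =>
    monotone_truncPow n (by linarith)
  exact h.intervalIntegrable

theorem intervalIntegrable_boxDensity_sub (n : ℕ) (z y a b : ℝ) :
    IntervalIntegrable (fun w => boxDensity n z (y - w)) volume a b := by
  unfold boxDensity
  refine IntervalIntegrable.const_mul ?_ _
  have := IntervalIntegrable.sum (Finset.range (n + 2)) (μ := volume) (a := a) (b := b)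
    (f := fun j w => (-1) ^ j * ((n + 1).choose j : ℝ) * truncPow n (y - w - j * z)) fun j _ => by
      refine IntervalIntegrable.const_mul ?_ _
      simpa only [sub_right_comm] using intervalIntegrable_truncPow_sub n (y - j * z) a b
  simpa only [Finset.sum_fn] using this

/-- Adding one coordinate convolves the density with the indicator of `(0, z]`. -/
theorem integral_boxDensity_sub (n : ℕ) (z y : ℝ) :
    ∫ w in (0 : ℝ)..z, boxDensity n z (y - w) = boxDensity (n + 1) z y := by
  unfold boxDensity
  rw [intervalIntegral.integral_const_mul, intervalIntegral.integral_finsetSum]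
  · have hc : ∀ (j : ℕ) (w : ℝ), y - w - j * z = y - j * z - w := fun j w => by ring
    simp_rw [intervalIntegral.integral_const_mul, hc, integral_truncPow_sub]
    have h : ∀ j : ℕ, y - j * z - z = y - ((j + 1 : ℕ) : ℝ) * z := fun j => by push_cast; ring
    simp_rw [h, ← mul_div_assoc]
    rw [← Finset.sum_div, sum_choose_sub_shift n fun j => truncPow (n + 1) (y - j * z),
      Nat.factorial_succ]
    push_cast
    field_simp
    exact Finset.sum_congr rfl fun j _ => by rw [mul_comm z]
  · intro j _
    refine IntervalIntegrable.const_mul ?_ _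
    have := intervalIntegrable_truncPow_sub n (y - j * z) 0 z
    simpa only [sub_right_comm] using this

theorem boxDensity_zero (z y : ℝ) (hz : 0 < z) :
    boxDensity 0 z y = (Set.Ioc 0 z).indicator (fun _ => (1 : ℝ)) y := by
  simp only [boxDensity, truncPow, Finset.sum_range_succ, Set.indicator, Set.mem_Ioc]
  norm_num
  by_cases h1 : 0 < y
  · by_cases h2 : z < y
    · simp [h1, h2]
    · simp [h1, h2, not_lt.1 h2]
  · have h2 : ¬ z < y := by linarith
    simp [h1, h2]

/-- The alternating sum hides the sign; the convolution recursion, started from an indicator, shows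
it. -/
theorem boxDensity_nonneg (n : ℕ) {z : ℝ} (hz : 0 < z) (y : ℝ) : 0 ≤ boxDensity n z y := by
  induction n generalizing y with
  | zero =>
    rw [boxDensity_zero z y hz]
    exact Set.indicator_nonneg (fun _ _ => zero_le_one) _
  | succ n ih =>
    rw [← integral_boxDensity_sub]
    exact intervalIntegral.integral_nonneg hz.le fun w _ => ih _

theorem boxDensity_of_nonpos (n : ℕ) {z y : ℝ} (hz : 0 < z) (hy : y ≤ 0) :
    boxDensity n z y = 0 := by
  unfold boxDensity
  rw [Finset.sum_eq_zero, mul_zero]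
  intro j _
  rw [truncPow_of_nonpos, mul_zero]
  have : 0 ≤ (j : ℝ) * z := by positivity
  linarith

theorem lintegral_expMeasure_restrict {z : ℝ} (g : ℝ → ENNReal) (hg : Measurable g) :
    ∫⁻ x, g x ∂((expMeasure 1).restrict (Set.Iic z)) =
      ∫⁻ x in Set.Ioc 0 z, ENNReal.ofReal (Real.exp (-x)) * g x := by
  rw [← lintegral_indicator measurableSet_Iic,
    lintegral_expMeasure_one _ (hg.indicator measurableSet_Iic),
    ← lintegral_indicator measurableSet_Ioi, ← lintegral_indicator measurableSet_Ioc]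
  refine lintegral_congr fun x => ?_
  by_cases h1 : 0 < x <;> by_cases h2 : x ≤ z <;> simp [Set.indicator, h1, h2]

/-- The product of exponential weights depends only on the sum. Inductively, splitting off a
coordinate `w` gives `e^{-w} e^{-(y-w)} = e^{-y}`, and only the convolution of box densities
remains. -/
theorem lintegral_sum_exp_box (n : ℕ) {z : ℝ} (hz : 0 < z) (g : ℝ → ENNReal)
    (hg : Measurable g) :
    ∫⁻ w, g (∑ i, w i)
        ∂(Measure.pi fun _ : Fin (n + 1) => (expMeasure 1).restrict (Set.Iic z)) =
      ∫⁻ y, g y * ENNReal.ofReal (Real.exp (-y) * boxDensity n z y) := by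
  induction n generalizing g with
  | zero =>
    have h1 := (measurePreserving_piUnique
      (fun _ : Fin 1 => (expMeasure 1).restrict (Set.Iic z))).lintegral_comp hg
    have h2 : ∀ w : Fin 1 → ℝ, MeasurableEquiv.piUnique (fun _ : Fin 1 => ℝ) w = ∑ i, w i :=
      fun w => by simp [MeasurableEquiv.piUnique]
    simp_rw [h2] at h1
    rw [zero_add, h1, lintegral_expMeasure_restrict g hg, ← lintegral_indicator measurableSet_Ioc]
    refine lintegral_congr fun y => ?_
    rw [boxDensity_zero z y hz]
    by_cases hy : y ∈ Set.Ioc 0 z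
    · simp [Set.indicator, hy, mul_comm]
    · simp [Set.indicator, hy]
  | succ n ih =>
    have h1 := (measurePreserving_piFinSuccAbove
      (fun _ : Fin (n + 2) => (expMeasure 1).restrict (Set.Iic z)) 0).lintegral_comp
        (f := fun p => g (p.1 + ∑ i, p.2 i)) (by fun_prop)
    have h2 : ∀ w : Fin (n + 2) → ℝ,
        (MeasurableEquiv.piFinSuccAbove (fun _ : Fin (n + 2) => ℝ) 0 w).1 +
          ∑ i, (MeasurableEquiv.piFinSuccAbove (fun _ : Fin (n + 2) => ℝ) 0 w).2 i = ∑ i, w i := by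
      intro w
      rw [Fin.sum_univ_succAbove w 0]
      rfl
    simp_rw [h2] at h1
    have hb : Measurable fun p : ℝ × ℝ => boxDensity n z (p.2 - p.1) :=
      (measurable_boxDensity n).comp (g := fun p : ℝ × ℝ => boxDensity n p.1 p.2)
        (f := fun p : ℝ × ℝ => (z, p.2 - p.1)) (by fun_prop)
    have hm : Measurable fun p : ℝ × (Fin (n + 1) → ℝ) => g (p.1 + ∑ i, p.2 i) := by fun_prop
    rw [h1, lintegral_prod _ hm.aemeasurable]
    have h3 : ∀ w : ℝ, ∫⁻ v, g (w + ∑ i, v i)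
          ∂(Measure.pi fun _ : Fin (n + 1) => (expMeasure 1).restrict (Set.Iic z)) =
        ∫⁻ y, g y * ENNReal.ofReal (Real.exp (-(y - w)) * boxDensity n z (y - w)) := by
      intro w
      rw [ih (fun s => g (w + s)) (by fun_prop), ← lintegral_sub_right_eq_self _ w]
      simp
    simp_rw [h3]
    rw [lintegral_expMeasure_restrict]
    swap
    · refine Measurable.lintegral_prod_right' (f := fun p : ℝ × ℝ =>
        g p.2 * ENNReal.ofReal (Real.exp (-(p.2 - p.1)) * boxDensity n z (p.2 - p.1))) ?_
      fun_prop
    have h4 : ∀ w : ℝ, ENNReal.ofReal (Real.exp (-w)) *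
          ∫⁻ y, g y * ENNReal.ofReal (Real.exp (-(y - w)) * boxDensity n z (y - w)) =
        ∫⁻ y, g y * ENNReal.ofReal (Real.exp (-y) * boxDensity n z (y - w)) := by
      intro w
      have hb' : Measurable fun y : ℝ => boxDensity n z (y - w) :=
        hb.comp (f := fun y => (w, y)) (by fun_prop)
      rw [← lintegral_const_mul _ (by fun_prop)]
      refine lintegral_congr fun y => ?_
      rw [mul_left_comm, ← ENNReal.ofReal_mul (Real.exp_nonneg _), ← mul_assoc, ← Real.exp_add]
      congr 4
      ring
    simp_rw [h4]
    rw [lintegral_lintegral_swap (by fun_prop)]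
    refine lintegral_congr fun y => ?_
    have hb' : Measurable fun w : ℝ => boxDensity n z (y - w) :=
      hb.comp (f := fun w => (w, y)) (by fun_prop)
    rw [lintegral_const_mul _ (by fun_prop)]
    simp_rw [ENNReal.ofReal_mul (Real.exp_nonneg _)]
    rw [lintegral_const_mul _ (by fun_prop), ← integral_boxDensity_sub,
      intervalIntegral.integral_of_le hz.le, ofReal_integral_eq_lintegral_ofReal]
    · exact (intervalIntegrable_iff_integrableOn_Ioc_of_le hz.le).1
        (intervalIntegrable_boxDensity_sub n z y 0 z)
    · exact Filter.Eventually.of_forall fun w => boxDensity_nonneg n hz _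

/-! ### Tails, Laplace transforms and null events for exponentials -/

theorem ae_pos_expMeasure : ∀ᵐ x ∂(expMeasure 1), 0 < x := by
  have hs : MeasurableSet {x : ℝ | ¬ 0 < x} :=
    (measurableSet_lt measurable_const measurable_id).compl
  rw [ae_iff, ← lintegral_indicator_one hs,
    lintegral_expMeasure_one _ (measurable_one.indicator hs),
    setLIntegral_congr_fun measurableSet_Ioi (g := fun _ => 0), lintegral_zero]
  intro x hx
  have : (0 : ℝ) < x := hx
  simp [Set.indicator, this]

theorem expMeasure_singleton (c : ℝ) : expMeasure 1 {c} = 0 := by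
  have h : expMeasure 1 ≪ volume := withDensity_absolutelyContinuous _ _
  exact h (by simp)

theorem expMeasure_Ioi {c : ℝ} (hc : 0 ≤ c) :
    expMeasure 1 (Set.Ioi c) = ENNReal.ofReal (Real.exp (-c)) := by
  rw [← lintegral_indicator_one measurableSet_Ioi,
    lintegral_expMeasure_one _ (measurable_one.indicator measurableSet_Ioi),
    ← integral_exp_neg_Ioi c, ofReal_integral_eq_lintegral_ofReal (integrableOn_exp_neg_Ioi c)
      (Filter.Eventually.of_forall fun _ => Real.exp_nonneg _),
    ← lintegral_indicator measurableSet_Ioi, ← lintegral_indicator measurableSet_Ioi]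
  refine lintegral_congr fun x => ?_
  by_cases h : c < x
  · simp [Set.indicator, h, hc.trans_lt h]
  · simp [Set.indicator, h]

theorem lintegral_exp_neg_mul_expMeasure {x : ℝ} (hx : 0 ≤ x) :
    ∫⁻ u, ENNReal.ofReal (Real.exp (-(x * u))) ∂(expMeasure 1) =
      ENNReal.ofReal (1 / (x + 1)) := by
  have hneg : -(x + 1) < 0 := by linarith
  rw [lintegral_expMeasure_one _ (by fun_prop)]
  have h := integral_exp_mul_Ioi hneg 0
  have h1 : 1 / (x + 1) = ∫ u in Set.Ioi (0 : ℝ), Real.exp (-(x + 1) * u) := by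
    rw [h, mul_zero, Real.exp_zero, neg_div_neg_eq]
  rw [h1, ofReal_integral_eq_lintegral_ofReal (integrableOn_exp_mul_Ioi hneg 0)
    (Filter.Eventually.of_forall fun _ => Real.exp_nonneg _)]
  refine lintegral_congr fun u => ?_
  rw [← ENNReal.ofReal_mul (Real.exp_nonneg _), ← Real.exp_add]
  congr 2
  ring

theorem lintegral_exp_neg_mul_sum (n : ℕ) {x : ℝ} (hx : 0 ≤ x) :
    ∫⁻ w, ENNReal.ofReal (Real.exp (-(x * ∑ i, w i)))
      ∂(Measure.pi fun _ : Fin n => expMeasure 1) = ENNReal.ofReal ((1 / (x + 1)) ^ n) := by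
  have hint : Integrable (fun u => Real.exp (-(x * u))) (expMeasure 1) := by
    refine Integrable.of_bound (Measurable.aestronglyMeasurable (by fun_prop)) 1 ?_
    filter_upwards [ae_pos_expMeasure] with u hu
    rw [Real.norm_of_nonneg (Real.exp_nonneg _), Real.exp_le_one_iff]
    nlinarith
  have h1 : ∀ w : Fin n → ℝ, Real.exp (-(x * ∑ i, w i)) = ∏ i, Real.exp (-(x * w i)) := by
    intro w
    rw [← Real.exp_sum, Finset.sum_neg_distrib, Finset.mul_sum]
  simp_rw [h1]
  rw [← ofReal_integral_eq_lintegral_ofReal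
    (Integrable.fintype_prod (f := fun (_ : Fin n) u => Real.exp (-(x * u))) fun _ => hint)
    (Filter.Eventually.of_forall fun _ => Finset.prod_nonneg fun _ _ => Real.exp_nonneg _),
    integral_fintype_prod_eq_prod (f := fun (_ : Fin n) u => Real.exp (-(x * u)))]
  have h2 : ∫ u, Real.exp (-(x * u)) ∂(expMeasure 1) = 1 / (x + 1) := by
    rw [integral_eq_lintegral_of_nonneg_ae
      (Filter.Eventually.of_forall fun _ => Real.exp_nonneg _) hint.aestronglyMeasurable,
      lintegral_exp_neg_mul_expMeasure hx, ENNReal.toReal_ofReal (by positivity)]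
  simp [h2]

theorem ae_pos_pi (n : ℕ) : ∀ᵐ g ∂(Measure.pi fun _ : Fin n => expMeasure 1), ∀ i, 0 < g i :=
  ae_all_iff.2 fun i => (Measure.quasiMeasurePreserving_eval
    (μ := fun _ : Fin n => expMeasure 1) i).ae ae_pos_expMeasure

/-- Separates one gain from the others, so that events can be evaluated by Fubini. -/
theorem pi_preimage_succAbove (n : ℕ) (i : Fin (n + 1)) {s : Set (ℝ × (Fin n → ℝ))}
    (hs : MeasurableSet s) :
    (Measure.pi fun _ : Fin (n + 1) => expMeasure 1)
        {g | (g i, fun j => g (i.succAbove j)) ∈ s} =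
      ((expMeasure 1).prod (Measure.pi fun _ : Fin n => expMeasure 1)) s :=
  (measurePreserving_piFinSuccAbove (fun _ : Fin (n + 1) => expMeasure 1) i).measure_preimage
    hs.nullMeasurableSet

/-- With the other coordinates fixed, a tie confines one coordinate to a single point, which the
exponential law does not charge. -/
theorem ae_ne_pi (n : ℕ) :
    ∀ᵐ g ∂(Measure.pi fun _ : Fin n => expMeasure 1), ∀ i j, i ≠ j → g i ≠ g j := by
  refine ae_all_iff.2 fun i => ae_all_iff.2 fun j => ?_
  by_cases hij : i = j
  · exact Filter.Eventually.of_forall fun _ h => absurd hij h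
  obtain _ | n := n
  · exact i.elim0
  obtain ⟨k, rfl⟩ := Fin.exists_succAbove_eq (Ne.symm hij)
  have hs : MeasurableSet {p : ℝ × (Fin n → ℝ) | p.1 = p.2 k} :=
    measurableSet_eq_fun measurable_fst (by fun_prop)
  have h0 : ((expMeasure 1).prod (Measure.pi fun _ : Fin n => expMeasure 1))
      {p : ℝ × (Fin n → ℝ) | p.1 = p.2 k} = 0 := by
    rw [Measure.prod_apply_symm hs]
    have : ∀ w : Fin n → ℝ, (fun x => (x, w)) ⁻¹' {p : ℝ × (Fin n → ℝ) | p.1 = p.2 k} = {w k} := by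
      intro w
      ext x
      simp
    simp_rw [this, expMeasure_singleton, lintegral_zero]
  rw [← pi_preimage_succAbove n i hs] at h0
  rw [ae_iff]
  convert h0 using 2
  ext g
  simp [hij]

theorem measure_eq_sum_of_ae_iff {α ι : Type*} [MeasurableSpace α] [Fintype ι] {μ : Measure α}
    {E : α → Prop} {A : ι → α → Prop} (hA : ∀ i, MeasurableSet {g | A i g})
    (hE : ∀ᵐ g ∂μ, E g ↔ ∃ i, A i g) (hd : ∀ᵐ g ∂μ, ∀ i j, A i g → A j g → i = j) :
    μ {g | E g} = ∑ i, μ {g | A i g} := by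
  have h1 : μ {g | E g} = μ (⋃ i, {g | A i g}) := by
    refine measure_congr ?_
    filter_upwards [hE] with g hg
    have : ({g | E g} g : Prop) = ((⋃ i, {g | A i g}) g : Prop) := by
      refine propext (hg.trans ?_)
      exact (Set.mem_iUnion (s := fun i => {g | A i g})).symm
    exact this
  rw [h1, measure_iUnion₀ _ fun i => (hA i).nullMeasurableSet, tsum_fintype]
  intro i j hij
  refine measure_mono_null ?_ hd
  intro g hg h
  exact hij (h i j hg.1 hg.2)

/-! ### Exceedance events and thresholds at least one -/

/-- The `n`-th ratio exceeds the threshold `x`, in terms of the gains. -/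
def Exceeds {N : ℕ} (a x : ℝ) (g : Fin N → ℝ) (n : Fin N) : Prop :=
  x * (a + ∑ i ∈ Finset.univ.erase n, g i) < g n

theorem sum_erase_eq_succAbove {n : ℕ} (g : Fin (n + 1) → ℝ) (i : Fin (n + 1)) :
    ∑ k ∈ Finset.univ.erase i, g k = ∑ j, g (i.succAbove j) := by
  have h1 := Finset.add_sum_erase Finset.univ g (Finset.mem_univ i)
  rw [Fin.sum_univ_succAbove g i] at h1
  exact add_left_cancel h1

theorem measurableSet_exceeds {N : ℕ} (a x : ℝ) (n : Fin N) :
    MeasurableSet {g : Fin N → ℝ | Exceeds a x g n} := by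
  unfold Exceeds
  exact measurableSet_lt (by fun_prop) (by fun_prop)

/-- Given the other gains with sum `S`, the exponential tail is `e^{-x(a+S)}`; averaging is the
Laplace transform of `S` at `x`. -/
theorem pi_exceeds (n : ℕ) {a x : ℝ} (ha : 0 ≤ a) (hx : 0 ≤ x) (i : Fin (n + 1)) :
    (Measure.pi fun _ : Fin (n + 1) => expMeasure 1) {g | Exceeds a x g i} =
      ENNReal.ofReal (Real.exp (-(x * a)) * (1 / (x + 1)) ^ n) := by
  have hs : MeasurableSet {p : ℝ × (Fin n → ℝ) | x * (a + ∑ j, p.2 j) < p.1} :=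
    measurableSet_lt (by fun_prop) (by fun_prop)
  have h1 : {g : Fin (n + 1) → ℝ | Exceeds a x g i} = {g | (g i, fun j => g (i.succAbove j)) ∈
      {p : ℝ × (Fin n → ℝ) | x * (a + ∑ j, p.2 j) < p.1}} := by
    ext g
    simp only [Exceeds, sum_erase_eq_succAbove, Set.mem_ofPred_eq]
  rw [h1, pi_preimage_succAbove n i hs, Measure.prod_apply_symm hs,
    ENNReal.ofReal_mul (Real.exp_nonneg _), ← lintegral_exp_neg_mul_sum n hx,
    ← lintegral_const_mul _ (by fun_prop)]
  refine lintegral_congr_ae ?_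
  filter_upwards [ae_pos_pi n] with w hw
  have h2 : (fun z => (z, w)) ⁻¹' {p : ℝ × (Fin n → ℝ) | x * (a + ∑ j, p.2 j) < p.1} =
      Set.Ioi (x * (a + ∑ j, w j)) := rfl
  have h3 : 0 ≤ ∑ j, w j := Finset.sum_nonneg fun j _ => (hw j).le
  rw [h2, expMeasure_Ioi (by positivity), ← ENNReal.ofReal_mul (Real.exp_nonneg _),
    ← Real.exp_add]
  congr 2
  ring

/-- Two exceedances with `x ≥ 1` would give both `g i > g j` and `g j > g i`, since each gain is
part of the other's interference. -/
theorem exceeds_unique {N : ℕ} {a x : ℝ} (ha : 0 < a) (hx : 1 ≤ x) {g : Fin N → ℝ}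
    (hg : ∀ i, 0 < g i) {i j : Fin N} (hi : Exceeds a x g i) (hj : Exceeds a x g j) : i = j := by
  by_contra hij
  unfold Exceeds at hi hj
  have h1 : g j ≤ ∑ k ∈ Finset.univ.erase i, g k :=
    Finset.single_le_sum (f := g) (fun k _ => (hg k).le)
      (Finset.mem_erase.2 ⟨Ne.symm hij, Finset.mem_univ j⟩)
  have h2 : g i ≤ ∑ k ∈ Finset.univ.erase j, g k :=
    Finset.single_le_sum (f := g) (fun k _ => (hg k).le)
      (Finset.mem_erase.2 ⟨hij, Finset.mem_univ i⟩)
  have := hg i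
  have := hg j
  nlinarith

theorem pi_exists_exceeds_of_one_le (n : ℕ) {a x : ℝ} (ha : 0 < a) (hx : 1 ≤ x) :
    (Measure.pi fun _ : Fin (n + 1) => expMeasure 1).real {g | ∃ i, Exceeds a x g i} =
      (n + 1 : ℕ) / (x + 1) ^ n * Real.exp (-(x * a)) := by
  have hx0 : 0 ≤ x := zero_le_one.trans hx
  rw [measureReal_def, measure_eq_sum_of_ae_iff (A := fun i g => Exceeds a x g i)
    (measurableSet_exceeds a x) (Filter.Eventually.of_forall fun _ => Iff.rfl)]
  · simp_rw [pi_exceeds n ha.le hx0]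
    rw [Finset.sum_const, Finset.card_univ, Fintype.card_fin, ENNReal.toReal_nsmul,
      ENNReal.toReal_ofReal (by positivity), nsmul_eq_mul, div_pow, one_pow]
    ring
  · filter_upwards [ae_pos_pi (n + 1)] with g hg i j hi hj
    exact exceeds_unique ha hx hg hi hj

/-! ### Reduction to the largest gain -/

/-- The joint density of the largest gain `z` and the sum `y` of the remaining `n + 1` gains on a
given choice of the largest one, restricted to `x * (a + y) < z`. -/
noncomputable def excessDensity (n : ℕ) (a x : ℝ) (p : ℝ × ℝ) : ℝ :=
  if 0 < p.1 ∧ x * (a + p.2) < p.1 then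
    Real.exp (-p.1) * (Real.exp (-p.2) * boxDensity n p.1 p.2) else 0

theorem excessDensity_nonneg (n : ℕ) (a x : ℝ) (p : ℝ × ℝ) : 0 ≤ excessDensity n a x p := by
  unfold excessDensity
  split_ifs with h
  · have := boxDensity_nonneg n h.1 p.2
    positivity
  · exact le_rfl

theorem measurable_excessDensity (n : ℕ) (a x : ℝ) : Measurable (excessDensity n a x) := by
  have := measurable_boxDensity n
  refine Measurable.ite (MeasurableSet.inter ?_ ?_) (by fun_prop) measurable_const
  · exact measurableSet_lt measurable_const measurable_fst
  · exact measurableSet_lt (by fun_prop) measurable_fst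

/-- Once `g i = z` is fixed, maximality confines the others to a box, so the product measure becomes
a product of restrictions and the box density applies. -/
theorem pi_exceeds_max (n : ℕ) (a x : ℝ) (i : Fin (n + 2)) :
    (Measure.pi fun _ : Fin (n + 2) => expMeasure 1)
        {g | Exceeds a x g i ∧ ∀ j, g (i.succAbove j) ≤ g i} =
      ∫⁻ p : ℝ × ℝ, ENNReal.ofReal (excessDensity n a x p) := by
  set S : Set (ℝ × (Fin (n + 1) → ℝ)) :=
    {p | x * (a + ∑ j, p.2 j) < p.1} ∩ ⋂ j, {p | p.2 j ≤ p.1} with hS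
  have hs : MeasurableSet S :=
    (measurableSet_lt (by fun_prop) (by fun_prop)).inter
      (MeasurableSet.iInter fun j => measurableSet_le (by fun_prop) (by fun_prop))
  have h1 : {g : Fin (n + 2) → ℝ | Exceeds a x g i ∧ ∀ j, g (i.succAbove j) ≤ g i} =
      {g | (g i, fun j => g (i.succAbove j)) ∈ S} := by
    ext g
    simp only [hS, Exceeds, sum_erase_eq_succAbove, Set.mem_ofPred_eq, Set.mem_inter_iff,
      Set.mem_iInter]
  have hm := (measurable_excessDensity n a x).ennreal_ofReal
  rw [h1, pi_preimage_succAbove (n + 1) i hs, Measure.prod_apply hs,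
    lintegral_expMeasure_one _ (measurable_measure_prodMk_left hs), Measure.volume_eq_prod,
    lintegral_prod _ hm.aemeasurable, ← lintegral_indicator measurableSet_Ioi]
  refine lintegral_congr fun z => ?_
  by_cases hz : 0 < z
  swap
  · simp [Set.indicator, excessDensity, hz]
  rw [Set.indicator_of_mem (Set.mem_Ioi.2 hz)]
  have hT : MeasurableSet {y : ℝ | x * (a + y) < z} :=
    measurableSet_lt (by fun_prop) (by fun_prop)
  have hT' : MeasurableSet {w : Fin (n + 1) → ℝ | x * (a + ∑ j, w j) < z} :=
    measurableSet_lt (by fun_prop) (by fun_prop)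
  have h2 : Prod.mk z ⁻¹' S = {w : Fin (n + 1) → ℝ | x * (a + ∑ j, w j) < z} ∩
      Set.pi Set.univ fun _ => Set.Iic z := by
    ext w
    simp [hS, Pi.le_def]
  have hbox : Measurable fun y => boxDensity n z y :=
    (measurable_boxDensity n).comp (f := fun y => (z, y)) (by fun_prop)
  rw [h2, ← Measure.restrict_apply hT', Measure.restrict_pi_pi,
    ← lintegral_indicator_one hT']
  have h3 := lintegral_sum_exp_box n hz ({y : ℝ | x * (a + y) < z}.indicator 1)
    (measurable_one.indicator hT)
  have h4 : ∀ w : Fin (n + 1) → ℝ,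
      {w : Fin (n + 1) → ℝ | x * (a + ∑ j, w j) < z}.indicator (1 : (Fin (n + 1) → ℝ) → ENNReal) w =
      {y : ℝ | x * (a + y) < z}.indicator 1 (∑ j, w j) := fun w => rfl
  simp_rw [h4]
  rw [h3, ← lintegral_const_mul _ (by
    exact (measurable_one.indicator hT).mul (by fun_prop))]
  refine lintegral_congr fun y => ?_
  by_cases hy : x * (a + y) < z
  · rw [excessDensity, if_pos ⟨hz, hy⟩, ENNReal.ofReal_mul (Real.exp_nonneg (-z)),
      Set.indicator_of_mem (by exact hy), Pi.one_apply, one_mul]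
  · rw [excessDensity, if_neg fun h => hy h.2, Set.indicator_of_notMem (by exact hy)]
    simp

/-- Passing to the largest gain raises the signal and lowers the interference, the total being
fixed. -/
theorem exists_exceeds_iff_max {n : ℕ} {a x : ℝ} (hx : 0 ≤ x)
    (g : Fin (n + 2) → ℝ) :
    (∃ i, Exceeds a x g i) ↔ ∃ i, Exceeds a x g i ∧ ∀ j, g (i.succAbove j) ≤ g i := by
  refine ⟨fun ⟨k, hk⟩ => ?_, fun ⟨i, hi, _⟩ => ⟨i, hi⟩⟩
  obtain ⟨i, hi⟩ := Finite.exists_max g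
  refine ⟨i, ?_, fun j => hi _⟩
  unfold Exceeds at hk ⊢
  have h1 := Finset.add_sum_erase Finset.univ g (Finset.mem_univ i)
  have h2 := Finset.add_sum_erase Finset.univ g (Finset.mem_univ k)
  have h3 := hi k
  nlinarith

/-- The integral is a probability, hence finite; no estimate is needed. -/
theorem integrable_excessDensity (n : ℕ) (a x : ℝ) : Integrable (excessDensity n a x) := by
  refine ⟨(measurable_excessDensity n a x).aestronglyMeasurable, ?_⟩
  rw [hasFiniteIntegral_iff_ofReal (Filter.Eventually.of_forall (excessDensity_nonneg n a x)),
    ← pi_exceeds_max n a x 0]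
  exact measure_lt_top _ _

theorem pi_exists_exceeds (n : ℕ) {a x : ℝ} (hx : 0 ≤ x) :
    (Measure.pi fun _ : Fin (n + 2) => expMeasure 1).real {g | ∃ i, Exceeds a x g i} =
      (n + 2 : ℕ) * ∫ p, excessDensity n a x p := by
  rw [measureReal_def, measure_eq_sum_of_ae_iff
    (A := fun i g => Exceeds a x g i ∧ ∀ j, g (i.succAbove j) ≤ g i)]
  · simp_rw [pi_exceeds_max]
    rw [Finset.sum_const, Finset.card_univ, Fintype.card_fin, ENNReal.toReal_nsmul, nsmul_eq_mul,
      integral_eq_lintegral_of_nonneg_ae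
        (Filter.Eventually.of_forall (excessDensity_nonneg n a x))
        (measurable_excessDensity n a x).aestronglyMeasurable]
  · intro i
    have e : {g : Fin (n + 2) → ℝ | Exceeds a x g i ∧ ∀ j, g (i.succAbove j) ≤ g i} =
        {g | Exceeds a x g i} ∩ ⋂ j, {g | g (i.succAbove j) ≤ g i} := by
      ext g
      simp
    rw [e]
    exact (measurableSet_exceeds a x i).inter
      (MeasurableSet.iInter fun j => measurableSet_le (by fun_prop) (by fun_prop))
  · exact Filter.Eventually.of_forall fun g => exists_exceeds_iff_max hx g
  · filter_upwards [ae_ne_pi (n + 2)] with g hg i j hi hj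
    by_contra hij
    obtain ⟨k, rfl⟩ := Fin.exists_succAbove_eq (Ne.symm hij)
    obtain ⟨l, hl⟩ := Fin.exists_succAbove_eq hij
    have h1 := hi.2 k
    have h2 := hj.2 l
    rw [hl] at h2
    exact hg _ _ hij (le_antisymm h2 h1)

theorem maxSINR_le_iff {Nt N : ℕ} (hN : 1 ≤ N) {PT σ2 : ℝ} (hPT : 0 < PT) (hσ2 : 0 < σ2)
    (h : Fin Nt → ℂ) (P : Matrix (Fin Nt) (Fin N) ℂ) (x : ℝ) :
    maxSINR PT σ2 h P ≤ x ↔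
      ¬ ∃ n, Exceeds (N / (PT / σ2)) x (fun n => beamGain h P n) n := by
  have : Nonempty (Fin N) := ⟨⟨0, hN⟩⟩
  have hN' : (0 : ℝ) < N := by exact_mod_cast hN
  unfold maxSINR
  rw [ciSup_le_iff (Set.finite_range _).bddAbove, not_exists]
  refine forall_congr' fun n => ?_
  have hnn : 0 ≤ ∑ i ∈ Finset.univ.erase n, beamGain h P i :=
    Finset.sum_nonneg fun i _ => by unfold beamGain; positivity
  unfold sinr Exceeds
  rw [← Finset.sum_mul, div_le_iff₀ (by positivity), not_lt]
  have e : x * (σ2 + (∑ i ∈ Finset.univ.erase n, beamGain h P i) * (PT / N)) =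
      x * (N / (PT / σ2) + ∑ i ∈ Finset.univ.erase n, beamGain h P i) * (PT / N) := by
    field_simp
  rw [e, mul_le_mul_iff_left₀ (by positivity)]

theorem measurable_maxSINR_gains {N : ℕ} (PT σ2 : ℝ) :
    Measurable fun g : Fin N → ℝ => ⨆ n : Fin N,
      g n * (PT / N) / (σ2 + ∑ i ∈ Finset.univ.erase n, g i * (PT / N)) :=
  Measurable.iSup fun n => by fun_prop

/-! ### Incomplete gamma integrals -/

/-- The closed form of the incomplete gamma integral `∫ y in Ioi A, y ^ n * exp (-(c * y))`. -/
noncomputable def upperGamma (n : ℕ) (c A : ℝ) : ℝ :=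
  (n.factorial : ℝ) / c ^ (n + 1) * Real.exp (-(c * A)) *
    ∑ u ∈ Finset.range (n + 1), c ^ u * (A ^ u / (u.factorial : ℝ))

theorem upperGamma_zero (c A : ℝ) : upperGamma 0 c A = 1 / c * Real.exp (-(c * A)) := by
  simp [upperGamma]

/-- Integration by parts in closed form; it drives the inductions for both the derivative and the
limit at infinity. -/
theorem upperGamma_succ (n : ℕ) {c : ℝ} (hc : c ≠ 0) (A : ℝ) :
    upperGamma (n + 1) c A =
      (n + 1) / c * upperGamma n c A + A ^ (n + 1) * Real.exp (-(c * A)) / c := by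
  unfold upperGamma
  rw [Finset.sum_range_succ _ (n + 1), Nat.factorial_succ]
  push_cast
  field_simp
  ring

theorem hasDerivAt_upperGamma (n : ℕ) {c : ℝ} (hc : c ≠ 0) (y : ℝ) :
    HasDerivAt (upperGamma n c) (-(y ^ n * Real.exp (-(c * y)))) y := by
  have he : HasDerivAt (fun y => Real.exp (-(c * y))) (-c * Real.exp (-(c * y))) y := by
    have := ((hasDerivAt_id' y).const_mul c).fun_neg.exp
    exact this.congr_deriv (by ring)
  induction n with
  | zero =>
    rw [show upperGamma 0 c = fun A => 1 / c * Real.exp (-(c * A)) from funext (upperGamma_zero c)]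
    refine (he.const_mul (1 / c)).congr_deriv ?_
    rw [pow_zero]
    field_simp
  | succ n ih =>
    rw [show upperGamma (n + 1) c = fun A => (n + 1) / c * upperGamma n c A +
      A ^ (n + 1) * Real.exp (-(c * A)) / c from funext (upperGamma_succ n hc)]
    refine ((ih.const_mul ((n + 1 : ℝ) / c)).fun_add
      (((hasDerivAt_pow (n + 1) y).fun_mul he).div_const c)).congr_deriv ?_
    push_cast
    field_simp
    ring_nf

theorem tendsto_upperGamma (n : ℕ) {c : ℝ} (hc : 0 < c) :
    Filter.Tendsto (upperGamma n c) Filter.atTop (nhds 0) := by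
  have hp : ∀ k : ℕ, Filter.Tendsto (fun y : ℝ => y ^ k * Real.exp (-(c * y))) Filter.atTop
      (nhds 0) := by
    intro k
    have := tendsto_rpow_mul_exp_neg_mul_atTop_nhds_zero k c hc
    simpa [Real.rpow_natCast] using this
  induction n with
  | zero =>
    rw [show upperGamma 0 c = fun A => 1 / c * (A ^ 0 * Real.exp (-(c * A))) from
      funext fun A => by rw [upperGamma_zero, pow_zero, one_mul]]
    simpa using (hp 0).const_mul (1 / c)
  | succ n ih =>
    rw [show upperGamma (n + 1) c = fun A => (n + 1) / c * upperGamma n c A +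
      A ^ (n + 1) * Real.exp (-(c * A)) / c from funext (upperGamma_succ n hc.ne')]
    simpa using (ih.const_mul ((n + 1 : ℝ) / c)).add ((hp (n + 1)).div_const c)

theorem integrableOn_pow_mul_exp (n : ℕ) {c A : ℝ} (hc : 0 < c) (hA : 0 ≤ A) :
    IntegrableOn (fun y => y ^ n * Real.exp (-(c * y))) (Set.Ioi A) := by
  refine integrableOn_Ioi_deriv_of_nonneg' (g := fun y => -upperGamma n c y) (l := -0)
    (fun y _ => ?_) (fun y hy => ?_) (tendsto_upperGamma n hc).neg
  · simpa using (hasDerivAt_upperGamma n hc.ne' y).fun_neg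
  · have : 0 < y := hA.trans_lt hy
    positivity

theorem integral_Ioi_pow_mul_exp (n : ℕ) {c A : ℝ} (hc : 0 < c) (hA : 0 ≤ A) :
    ∫ y in Set.Ioi A, y ^ n * Real.exp (-(c * y)) = upperGamma n c A := by
  rw [integral_Ioi_of_hasDerivAt_of_tendsto' (f := fun y => -upperGamma n c y) (m := -0)
    (fun y _ => ?_) (integrableOn_pow_mul_exp n hc hA) (tendsto_upperGamma n hc).neg]
  · simp
  · simpa using (hasDerivAt_upperGamma n hc.ne' y).fun_neg

/-! ### The operator `xi` and the integrals of its terms -/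

theorem xi_congr {N p : ℕ} {f g : ℕ → ℕ → ℝ}
    (h : ∀ i < N - 1, ∀ l ≤ i, f i l = g i l) : xi N p f = xi N p g := by
  unfold xi
  congr 1
  refine Finset.sum_congr rfl fun t _ => ?_
  congr 1
  refine Finset.sum_congr rfl fun i hi => ?_
  congr 1
  exact Finset.sum_congr rfl fun l hl =>
    h i (Finset.mem_range.1 hi) l (Nat.lt_succ_iff.1 (Finset.mem_range.1 hl))

theorem integrableOn_xi {N p : ℕ} {f : ℝ → ℕ → ℕ → ℝ} {s : Set ℝ}
    (h : ∀ i < N - 1, ∀ l ≤ i, IntegrableOn (fun y => f y i l) s) :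
    IntegrableOn (fun y => xi N p (f y)) s := by
  unfold xi
  refine Integrable.const_mul (integrable_finsetSum _ fun t _ => Integrable.const_mul
    (integrable_finsetSum _ fun i hi => Integrable.const_mul
      (integrable_finsetSum _ fun l hl => ?_) _) _) _
  exact h i (Finset.mem_range.1 hi) l (Nat.lt_succ_iff.1 (Finset.mem_range.1 hl))

theorem integral_xi {N p : ℕ} {f : ℝ → ℕ → ℕ → ℝ} {s : Set ℝ}
    (h : ∀ i < N - 1, ∀ l ≤ i, IntegrableOn (fun y => f y i l) s) :
    ∫ y in s, xi N p (f y) = xi N p fun i l => ∫ y in s, f y i l := by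
  have h1 : ∀ i ∈ Finset.range (N - 1), ∀ l ∈ Finset.range (i + 1),
      IntegrableOn (fun y => f y i l) s := fun i hi l hl =>
    h i (Finset.mem_range.1 hi) l (Nat.lt_succ_iff.1 (Finset.mem_range.1 hl))
  have h2 : ∀ i ∈ Finset.range (N - 1),
      IntegrableOn (fun y => ∑ l ∈ Finset.range (i + 1), f y i l) s := fun i hi =>
    integrable_finsetSum _ (h1 i hi)
  unfold xi
  rw [integral_const_mul, integral_finsetSum]
  · congr 1
    refine Finset.sum_congr rfl fun t _ => ?_
    rw [integral_const_mul, integral_finsetSum]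
    · congr 1
      refine Finset.sum_congr rfl fun i hi => ?_
      rw [integral_const_mul, integral_finsetSum _ (h1 i hi)]
    · exact fun i hi => (h2 i hi).const_mul _
  · exact fun t _ => (integrable_finsetSum _ fun i hi => (h2 i hi).const_mul _).const_mul _

/-- The integrand in `y` coming from the `z`-endpoint `x * (a + y)`. -/
theorem threshold_term_eq (q l : ℕ) (a x y : ℝ) :
    Real.exp (-y) * y ^ q * (Real.exp (-(x * (a + y))) * ((x * (a + y)) ^ l / (l.factorial : ℝ))) =
      ∑ v ∈ Finset.range (l + 1), Real.exp (-(x * a)) * (x ^ l / (l.factorial : ℝ)) *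
        ((l.choose v : ℝ) * a ^ (l - v)) * (y ^ (q + v) * Real.exp (-((x + 1) * y))) := by
  rw [mul_pow, add_comm a y, add_pow, Finset.mul_sum, Finset.sum_div, Finset.mul_sum,
    Finset.mul_sum]
  refine Finset.sum_congr rfl fun v _ => ?_
  have h : Real.exp (-(x * (y + a))) * Real.exp (-y) =
      Real.exp (-(x * a)) * Real.exp (-((x + 1) * y)) := by
    rw [← Real.exp_add, ← Real.exp_add]
    congr 1
    ring
  rw [pow_add]
  linear_combination (y ^ q * (x ^ l * (y ^ v * a ^ (l - v) * (l.choose v : ℝ)) /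
    (l.factorial : ℝ))) * h

/-- The integrand in `y` coming from the `z`-endpoint `y / κ`. -/
theorem ratio_term_eq (q l : ℕ) {κ : ℝ} (hκ : κ ≠ 0) (y : ℝ) :
    Real.exp (-y) * y ^ q * (Real.exp (-(y / κ)) * ((y / κ) ^ l / (l.factorial : ℝ))) =
      1 / (κ ^ l * (l.factorial : ℝ)) *
        (y ^ (q + l) * Real.exp (-((κ + 1) / κ * y))) := by
  have h : Real.exp (-y) * Real.exp (-(y / κ)) = Real.exp (-((κ + 1) / κ * y)) := by
    rw [← Real.exp_add]
    congr 1
    field_simp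
    ring
  rw [← h, pow_add, div_pow]
  field_simp

theorem integrableOn_threshold_term (q l : ℕ) {a x A : ℝ} (hx : 0 < x) (hA : 0 ≤ A) :
    IntegrableOn (fun y => Real.exp (-y) * y ^ q *
      (Real.exp (-(x * (a + y))) * ((x * (a + y)) ^ l / (l.factorial : ℝ)))) (Set.Ioi A) := by
  simp_rw [threshold_term_eq]
  exact integrable_finsetSum _ fun v _ =>
    (integrableOn_pow_mul_exp _ (by linarith) hA).const_mul _

theorem integrableOn_ratio_term (q l : ℕ) {κ A : ℝ} (hκ : 0 < κ) (hA : 0 ≤ A) :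
    IntegrableOn (fun y => Real.exp (-y) * y ^ q *
      (Real.exp (-(y / κ)) * ((y / κ) ^ l / (l.factorial : ℝ)))) (Set.Ioi A) := by
  simp_rw [ratio_term_eq q l hκ.ne']
  exact (integrableOn_pow_mul_exp _ (by positivity) hA).const_mul _

theorem integral_Ioi_threshold_term (q l : ℕ) {a x A : ℝ} (hx : 0 < x) (hA : 0 ≤ A) :
    ∫ y in Set.Ioi A, Real.exp (-y) * y ^ q *
      (Real.exp (-(x * (a + y))) * ((x * (a + y)) ^ l / (l.factorial : ℝ))) =
    Real.exp (-(x * a)) * (x ^ l / (l.factorial : ℝ)) * ∑ v ∈ Finset.range (l + 1),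
      (l.choose v : ℝ) * a ^ (l - v) * upperGamma (q + v) (x + 1) A := by
  simp_rw [threshold_term_eq]
  rw [integral_finsetSum _ fun v _ =>
    (integrableOn_pow_mul_exp _ (by linarith) hA).const_mul _, Finset.mul_sum]
  refine Finset.sum_congr rfl fun v _ => ?_
  rw [integral_const_mul, integral_Ioi_pow_mul_exp _ (by linarith) hA]
  ring

theorem integral_Ioi_ratio_term (q l : ℕ) {κ A : ℝ} (hκ : 0 < κ) (hA : 0 ≤ A) :
    ∫ y in Set.Ioi A, Real.exp (-y) * y ^ q *
      (Real.exp (-(y / κ)) * ((y / κ) ^ l / (l.factorial : ℝ))) =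
    1 / (κ ^ l * (l.factorial : ℝ)) * upperGamma (q + l) ((κ + 1) / κ) A := by
  simp_rw [ratio_term_eq q l hκ.ne']
  rw [integral_const_mul, integral_Ioi_pow_mul_exp _ (by positivity) hA]

theorem setIntegral_Ioc_eq_sub {f : ℝ → ℝ} {A B : ℝ} (hAB : A ≤ B)
    (hf : IntegrableOn f (Set.Ioi A)) :
    ∫ y in Set.Ioc A B, f y = (∫ y in Set.Ioi A, f y) - ∫ y in Set.Ioi B, f y := by
  have h := setIntegral_union (Set.Ioc_disjoint_Ioi (a := A) (b := B) le_rfl) measurableSet_Ioi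
    (hf.mono_set Set.Ioc_subset_Ioi_self) (hf.mono_set (Set.Ioi_subset_Ioi hAB))
  rw [Set.Ioc_union_Ioi_eq_Ioi hAB] at h
  linarith

/-! ### Wedge decomposition of the joint density -/

/-- On the wedge `(k - 1) z < y ≤ k z` only the first `k` truncated powers survive. -/
noncomputable def wedgeDensity (n k : ℕ) (y z : ℝ) : ℝ :=
  Real.exp (-z) * (Real.exp (-y) * (1 / (n.factorial : ℝ) * ∑ t ∈ Finset.Icc 1 k,
    ((n + 1).choose (t - 1) : ℝ) * (-1) ^ (t + 1) * (y + (1 - (t : ℝ)) * z) ^ n))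

theorem boxDensity_eq_on_wedge (n k : ℕ) {z y : ℝ} (hz : 0 < z) (h1 : ((k : ℝ) - 1) * z < y)
    (h2 : y ≤ k * z) :
    Real.exp (-z) * (Real.exp (-y) * boxDensity n z y) = wedgeDensity n k y z := by
  unfold boxDensity wedgeDensity
  congr 3
  have e1 : ∑ t ∈ Finset.Icc 1 k, ((n + 1).choose (t - 1) : ℝ) * (-1) ^ (t + 1) *
      (y + (1 - (t : ℝ)) * z) ^ n =
      ∑ j ∈ Finset.range k, (-1) ^ j * ((n + 1).choose j : ℝ) * truncPow n (y - j * z) := by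
    rw [← Finset.Ico_add_one_right_eq_Icc, Finset.sum_Ico_eq_sum_range]
    refine Finset.sum_congr (by simp) fun j hj => ?_
    have hj' : (j : ℝ) + 1 ≤ k := by
      have := Finset.mem_range.1 hj
      exact_mod_cast (by omega : j + 1 ≤ k)
    have hpos : 0 < y - j * z := by nlinarith
    rw [truncPow, if_pos hpos, show 1 + j - 1 = j by omega, show 1 + j + 1 = j + 2 by omega,
      pow_add]
    push_cast
    ring
  rw [e1]
  have e2 : ∀ p q : ℕ, p ≤ q → (∀ j, p ≤ j → j < q → (-1) ^ j * ((n + 1).choose j : ℝ) *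
      truncPow n (y - j * z) = 0) →
      ∑ j ∈ Finset.range p, (-1) ^ j * ((n + 1).choose j : ℝ) * truncPow n (y - j * z) =
      ∑ j ∈ Finset.range q, (-1) ^ j * ((n + 1).choose j : ℝ) * truncPow n (y - j * z) := by
    intro p q hpq h
    refine Finset.sum_subset (Finset.range_mono hpq) fun j hj hj' => h j ?_ ?_
    · simpa using hj'
    · simpa using hj
  -- The box sum has `n + 2` terms. If `k` is smaller, the missing truncated powers vanish on the
  -- wedge; if larger, the extra binomial coefficients vanish.
  rcases le_total k (n + 2) with hk | hk
  · refine (e2 _ _ hk fun j hj _ => ?_).symm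
    have : (k : ℝ) ≤ j := by exact_mod_cast hj
    rw [truncPow_of_nonpos, mul_zero]
    nlinarith
  · refine e2 _ _ hk fun j hj _ => ?_
    rw [Nat.choose_eq_zero_of_lt (by omega), Nat.cast_zero, mul_zero, zero_mul]

theorem wedgeDensity_eq_sum (n k : ℕ) (y z : ℝ) :
    wedgeDensity n k y z = ∑ t ∈ Finset.Icc 1 k, ∑ i ∈ Finset.range (n + 1),
      1 / (n.factorial : ℝ) * (((n + 1).choose (t - 1) : ℝ) * (-1) ^ (t + 1)) *
        ((n.choose i : ℝ) * (1 - (t : ℝ)) ^ i) * (Real.exp (-y) * y ^ (n - i)) *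
          (z ^ i * Real.exp (-(1 * z))) := by
  unfold wedgeDensity
  rw [Finset.mul_sum, Finset.mul_sum, Finset.mul_sum]
  refine Finset.sum_congr rfl fun t _ => ?_
  rw [add_comm y, add_pow]
  simp_rw [Finset.mul_sum]
  refine Finset.sum_congr rfl fun i _ => ?_
  rw [mul_pow, one_mul]
  ring

theorem integrableOn_wedgeDensity (n k : ℕ) (y : ℝ) {A : ℝ} (hA : 0 ≤ A) :
    IntegrableOn (wedgeDensity n k y) (Set.Ioi A) := by
  rw [show wedgeDensity n k y = _ from funext (wedgeDensity_eq_sum n k y)]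
  exact integrable_finsetSum _ fun t _ => integrable_finsetSum _ fun i _ =>
    (integrableOn_pow_mul_exp i one_pos hA).const_mul _

/-- The origin of `xi`: `t` indexes the truncated powers, `i` the binomial expansion separating `y`
from `z`, and `l` the incomplete gamma sum, which also supplies `i!`. The prefactor `N` counts the
choices of the largest gain. -/
theorem integral_Ioi_wedgeDensity (n k : ℕ) (y : ℝ) {A : ℝ} (hA : 0 ≤ A) :
    ((n + 2 : ℕ) : ℝ) * ∫ z in Set.Ioi A, wedgeDensity n k y z =
      xi (n + 2) k fun i l => Real.exp (-y) * y ^ (n - i) *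
        (Real.exp (-A) * (A ^ l / (l.factorial : ℝ))) := by
  simp_rw [wedgeDensity_eq_sum]
  have hi : ∀ (i : ℕ) (C : ℝ), IntegrableOn (fun z => C * (z ^ i * Real.exp (-(1 * z))))
      (Set.Ioi A) := fun i C => (integrableOn_pow_mul_exp i one_pos hA).const_mul C
  rw [integral_finsetSum _ fun t _ => integrable_finsetSum _ fun i _ => hi i _]
  unfold xi
  rw [Finset.mul_sum, Finset.mul_sum]
  refine Finset.sum_congr rfl fun t _ => ?_
  rw [integral_finsetSum _ fun i _ => hi i _]
  simp only [Finset.mul_sum, Nat.add_sub_cancel, show n + 2 - 1 = n + 1 by omega]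
  refine Finset.sum_congr rfl fun i _ => ?_
  rw [integral_const_mul, integral_Ioi_pow_mul_exp i one_pos hA, upperGamma]
  simp only [Finset.mul_sum, one_pow, one_mul, div_one]
  refine Finset.sum_congr rfl fun l _ => ?_
  ring

theorem xi_sub (N p : ℕ) (f g : ℕ → ℕ → ℝ) :
    xi N p (fun i l => f i l - g i l) = xi N p f - xi N p g := by
  simp only [xi, Finset.sum_sub_distrib, mul_sub]

theorem integral_Ioc_wedgeDensity (n k : ℕ) (y : ℝ) {A B : ℝ} (hA : 0 ≤ A) (hAB : A ≤ B) :
    ((n + 2 : ℕ) : ℝ) * ∫ z in Set.Ioc A B, wedgeDensity n k y z =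
      xi (n + 2) k fun i l =>
        Real.exp (-y) * y ^ (n - i) * (Real.exp (-A) * (A ^ l / (l.factorial : ℝ))) -
        Real.exp (-y) * y ^ (n - i) * (Real.exp (-B) * (B ^ l / (l.factorial : ℝ))) := by
  rw [setIntegral_Ioc_eq_sub hAB (integrableOn_wedgeDensity n k y hA), mul_sub,
    integral_Ioi_wedgeDensity n k y hA, integral_Ioi_wedgeDensity n k y (hA.trans hAB), xi_sub]

/-- The contribution of the wedge `(k - 1) z < y ≤ k z` to the integral over `z`. -/
noncomputable def wedgeSlice (n : ℕ) (a x : ℝ) (k : ℕ) (y : ℝ) : ℝ :=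
  ∫ z, {p : ℝ × ℝ | ((k : ℝ) - 1) * p.1 < p.2 ∧ p.2 ≤ k * p.1}.indicator
    (excessDensity n a x) (z, y)

theorem measurableSet_wedge (k : ℕ) :
    MeasurableSet {p : ℝ × ℝ | ((k : ℝ) - 1) * p.1 < p.2 ∧ p.2 ≤ k * p.1} :=
  (measurableSet_lt (f := fun p : ℝ × ℝ => ((k : ℝ) - 1) * p.1) (g := fun p => p.2)
    (by fun_prop) (by fun_prop)).inter
    (measurableSet_le (f := fun p : ℝ × ℝ => p.2) (g := fun p => k * p.1)
      (by fun_prop) (by fun_prop))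

theorem excessDensity_of_nonpos (n : ℕ) (a x : ℝ) {z y : ℝ} (hy : y ≤ 0) :
    excessDensity n a x (z, y) = 0 := by
  unfold excessDensity
  split_ifs with h
  · rw [boxDensity_of_nonpos n h.1 hy, mul_zero, mul_zero]
  · rfl

/-- The density vanishes unless `z, y > 0`, and then `(z, y)` lies in the single wedge `k = ⌈y /
z⌉`. -/
theorem sum_wedge_excessDensity (n : ℕ) {a x : ℝ} (ha : 0 < a) (hx : 0 < x) {m : ℕ}
    (hm : 1 ≤ m * x) (p : ℝ × ℝ) :
    excessDensity n a x p = ∑ k ∈ Finset.Icc 1 m,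
      {p : ℝ × ℝ | ((k : ℝ) - 1) * p.1 < p.2 ∧ p.2 ≤ k * p.1}.indicator
        (excessDensity n a x) p := by
  obtain ⟨z, y⟩ := p
  by_cases h : excessDensity n a x (z, y) = 0
  · rw [h, Finset.sum_eq_zero]
    intro k _
    by_cases hk : (z, y) ∈ {p : ℝ × ℝ | ((k : ℝ) - 1) * p.1 < p.2 ∧ p.2 ≤ k * p.1}
    · rw [Set.indicator_of_mem hk, h]
    · rw [Set.indicator_of_notMem hk]
  have hz : 0 < z ∧ x * (a + y) < z := by
    by_contra hc
    exact h (if_neg hc)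
  have hy : 0 < y := by
    by_contra hc
    exact h (excessDensity_of_nonpos n a x (not_lt.1 hc))
  obtain ⟨hz, hxz⟩ := hz
  have hyz : 0 < y / z := by positivity
  have hk1 : (⌈y / z⌉₊ : ℝ) - 1 < y / z := by
    have := Nat.ceil_lt_add_one hyz.le
    linarith
  have hk2 := Nat.le_ceil (y / z)
  rw [lt_div_iff₀ hz] at hk1
  rw [div_le_iff₀ hz] at hk2
  rw [Finset.sum_eq_single ⌈y / z⌉₊, Set.indicator_of_mem]
  · exact ⟨hk1, hk2⟩
  · intro k _ hne
    refine Set.indicator_of_notMem (fun hk => hne ?_) _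
    have h1 : ((k : ℝ) - 1) * z < y := hk.1
    have h2 : y ≤ k * z := hk.2
    refine le_antisymm ?_ (Nat.ceil_le.2 ((div_le_iff₀ hz).2 h2))
    have : (k : ℝ) - 1 < ⌈y / z⌉₊ := by
      by_contra hc
      nlinarith [not_lt.1 hc]
    have : (k : ℝ) < (⌈y / z⌉₊ + 1 : ℕ) := by push_cast; linarith
    exact Nat.lt_succ_iff.1 (by exact_mod_cast this)
  · intro hn
    exfalso
    refine hn (Finset.mem_Icc.2 ⟨Nat.ceil_pos.2 hyz, Nat.ceil_le.2 ?_⟩)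
    rw [div_le_iff₀ hz]
    -- The chain is `y ≤ m x y ≤ m x (a + y) ≤ m z`.
    have hm0 : (0 : ℝ) ≤ m := Nat.cast_nonneg m
    nlinarith [mul_pos hx ha, mul_nonneg hm0 (sub_nonneg.2 hxz.le),
      mul_nonneg hm0 (mul_pos hx ha).le, mul_nonneg hy.le (sub_nonneg.2 hm)]

theorem integral_excessDensity (n : ℕ) {a x : ℝ} (ha : 0 < a) (hx : 0 < x) {m : ℕ}
    (hm : 1 ≤ m * x) :
    ∫ p, excessDensity n a x p = ∑ k ∈ Finset.Icc 1 m, ∫ y, wedgeSlice n a x k y := by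
  have hint : ∀ k : ℕ, Integrable
      ({p : ℝ × ℝ | ((k : ℝ) - 1) * p.1 < p.2 ∧ p.2 ≤ k * p.1}.indicator
        (excessDensity n a x)) := fun k =>
    (integrable_excessDensity n a x).indicator (measurableSet_wedge k)
  rw [show excessDensity n a x = _ from funext (sum_wedge_excessDensity n ha hx hm),
    integral_finsetSum _ fun k _ => hint k]
  refine Finset.sum_congr rfl fun k _ => ?_
  have := hint k
  rw [Measure.volume_eq_prod] at this ⊢
  exact integral_prod_symm _ this

theorem wedgeSlice_of_nonpos (n : ℕ) (a x : ℝ) (k : ℕ) {y : ℝ} (hy : y ≤ 0) :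
    wedgeSlice n a x k y = 0 := by
  unfold wedgeSlice
  simp [Set.indicator, excessDensity_of_nonpos n a x hy]

theorem wedgeSlice_eq (n : ℕ) (a x : ℝ) (k : ℕ) (y : ℝ) {s : Set ℝ}
    (hs : MeasurableSet s)
    (h : ∀ z, z ∈ s ↔ 0 < z ∧ x * (a + y) < z ∧ ((k : ℝ) - 1) * z < y ∧ y ≤ k * z) :
    wedgeSlice n a x k y = ∫ z in s, wedgeDensity n k y z := by
  rw [wedgeSlice, ← integral_indicator hs]
  congr 1
  funext z
  by_cases hz : z ∈ s
  · obtain ⟨h1, h2, h3, h4⟩ := (h z).1 hz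
    rw [Set.indicator_of_mem hz, Set.indicator_of_mem (show (z, y) ∈
      {p : ℝ × ℝ | ((k : ℝ) - 1) * p.1 < p.2 ∧ p.2 ≤ k * p.1} from ⟨h3, h4⟩),
      excessDensity, if_pos ⟨h1, h2⟩, boxDensity_eq_on_wedge n k h1 h3 h4]
  · rw [Set.indicator_of_notMem hz]
    by_cases hk : (z, y) ∈ {p : ℝ × ℝ | ((k : ℝ) - 1) * p.1 < p.2 ∧ p.2 ≤ k * p.1}
    · rw [Set.indicator_of_mem hk, excessDensity, if_neg]
      exact fun hc => hz ((h z).2 ⟨hc.1, hc.2, hk.1, hk.2⟩)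
    · rw [Set.indicator_of_notMem hk]

theorem wedgeSlice_one_of_le (n : ℕ) {a x y : ℝ} (ha : 0 < a) (hx : 0 < x) (hy : 0 < y)
    (h : y ≤ x * (a + y)) :
    wedgeSlice n a x 1 y = ∫ z in Set.Ioi (x * (a + y)), wedgeDensity n 1 y z := by
  refine wedgeSlice_eq n a x 1 y measurableSet_Ioi fun z => ⟨fun hz => ?_, fun hz => hz.2.1⟩
  have hz' : x * (a + y) < z := hz
  have : 0 < x * (a + y) := by positivity
  refine ⟨by linarith, hz', ?_, ?_⟩ <;> push_cast <;> linarith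

/-- The endpoint is kept as `y / 1` to match the general ratio term at `κ = 1`. -/
theorem wedgeSlice_one_of_lt (n : ℕ) {a x y : ℝ} (hy : 0 < y) (h : x * (a + y) < y) :
    wedgeSlice n a x 1 y = ∫ z in Set.Ioi (y / 1), wedgeDensity n 1 y z := by
  rw [div_one, ← integral_Ici_eq_integral_Ioi]
  refine wedgeSlice_eq n a x 1 y measurableSet_Ici fun z => ⟨fun hz => ?_, fun hz => ?_⟩
  · have hz' : y ≤ z := hz
    refine ⟨by linarith, by linarith, ?_, ?_⟩ <;> push_cast <;> linarith
  · have := hz.2.2.2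
    push_cast at this
    rwa [one_mul] at this

/-- The lower bound `x (a + y)` for `z` has already reached the upper bound `y / (k - 1)`. -/
theorem wedgeSlice_eq_zero (n : ℕ) {a x y : ℝ} {k : ℕ} (hk : 2 ≤ k)
    (h : y ≤ ((k : ℝ) - 1) * (x * (a + y))) : wedgeSlice n a x k y = 0 := by
  have hk' : (2 : ℝ) ≤ k := by exact_mod_cast hk
  rw [wedgeSlice_eq n a x k y MeasurableSet.empty fun z => ⟨fun hz => absurd hz id, fun hz => ?_⟩]
  · simp
  · obtain ⟨_, h2, h3, _⟩ := hz
    exfalso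
    nlinarith

theorem wedgeSlice_of_le (n : ℕ) {a x y : ℝ} {k : ℕ} (ha : 0 < a) (hx : 0 < x) (hy : 0 < y)
    (hk : 2 ≤ k) (h : y ≤ k * (x * (a + y))) :
    wedgeSlice n a x k y =
      ∫ z in Set.Ioc (x * (a + y)) (y / ((k : ℝ) - 1)), wedgeDensity n k y z := by
  have hk' : (2 : ℝ) ≤ k := by exact_mod_cast hk
  have hκ : 0 < (k : ℝ) - 1 := by linarith
  rw [integral_Ioc_eq_integral_Ioo]
  refine wedgeSlice_eq n a x k y measurableSet_Ioo fun z => ⟨fun hz => ?_, fun hz => ?_⟩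
  · obtain ⟨h1, h2⟩ := hz
    rw [lt_div_iff₀ hκ] at h2
    have : 0 < x * (a + y) := by positivity
    exact ⟨by linarith, h1, by linarith, by nlinarith⟩
  · exact ⟨hz.2.1, by rw [lt_div_iff₀ hκ]; linarith [hz.2.2.1]⟩

theorem wedgeSlice_of_lt (n : ℕ) {a x y : ℝ} {k : ℕ} (hy : 0 < y)
    (hk : 2 ≤ k) (h : k * (x * (a + y)) < y) :
    wedgeSlice n a x k y =
      ∫ z in Set.Ioc (y / k) (y / ((k : ℝ) - 1)), wedgeDensity n k y z := by
  have hk' : (2 : ℝ) ≤ k := by exact_mod_cast hk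
  have hκ : 0 < (k : ℝ) - 1 := by linarith
  have hk0 : 0 < (k : ℝ) := by linarith
  rw [← integral_Ico_eq_integral_Ioc]
  refine wedgeSlice_eq n a x k y measurableSet_Ico fun z => ⟨fun hz => ?_, fun hz => ?_⟩
  · obtain ⟨h1, h2⟩ := hz
    rw [lt_div_iff₀ hκ] at h2
    have h3 : 0 < z := (div_pos hy hk0).trans_le h1
    rw [div_le_iff₀ hk0] at h1
    exact ⟨h3, by nlinarith, by linarith, by linarith⟩
  · exact ⟨by rw [div_le_iff₀ hk0]; linarith [hz.2.2.2],
      by rw [lt_div_iff₀ hκ]; linarith [hz.2.2.1]⟩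

/-! ### Breakpoints in `y` and piecewise integration -/

/-- `b_k` solves `y / k = x (N/ρ + y)`, where the wedge boundary meets the threshold line; `k x < 1`
makes the crossing unique and fixes its direction. -/
theorem le_bPt_iff {N : ℕ} {ρ x y : ℝ} {k : ℕ} (hρ : 0 < ρ) (hk : 1 ≤ k) (hkx : k * x < 1) :
    y ≤ bPt N ρ x k ↔ y ≤ k * (x * (N / ρ + y)) := by
  have hk0 : (0 : ℝ) < k := by exact_mod_cast hk
  have h1 : 0 < 1 / (k : ℝ) - x := by
    rw [sub_pos, lt_div_iff₀ hk0]
    linarith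
  unfold bPt
  rw [le_div_iff₀ (by positivity)]
  have e : k * (x * (N / ρ + y)) - y = (x * N - y * (ρ * (1 / k - x))) * (k / ρ) := by
    field_simp
    ring
  have h2 : 0 < (k : ℝ) / ρ := by positivity
  constructor
  · intro h
    have := mul_nonneg (sub_nonneg.2 h) h2.le
    linarith
  · intro h
    by_contra hc
    have := mul_pos_of_neg_of_neg (sub_neg.2 (not_le.1 hc)) (neg_neg_of_pos h2)
    linarith

theorem bPt_pos {N : ℕ} {ρ x : ℝ} {k : ℕ} (hN : 0 < N) (hρ : 0 < ρ) (hx : 0 < x) (hk : 1 ≤ k)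
    (hkx : k * x < 1) : 0 < bPt N ρ x k := by
  have hk0 : (0 : ℝ) < k := by exact_mod_cast hk
  have hN0 : (0 : ℝ) < N := by exact_mod_cast hN
  have h1 : 0 < 1 / (k : ℝ) - x := by
    rw [sub_pos, lt_div_iff₀ hk0]
    linarith
  unfold bPt
  positivity

theorem bPt_mono {N : ℕ} {ρ x : ℝ} {j k : ℕ} (hN : 0 < N) (hρ : 0 < ρ) (hx : 0 < x)
    (hj : 1 ≤ j) (hjk : j ≤ k) (hkx : k * x < 1) : bPt N ρ x j ≤ bPt N ρ x k := by
  have hjk' : (j : ℝ) ≤ k := by exact_mod_cast hjk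
  have hjx : j * x < 1 := by nlinarith
  have hb := bPt_pos hN hρ hx hj hjx
  have hN0 : (0 : ℝ) < N := by exact_mod_cast hN
  rw [le_bPt_iff hρ (hj.trans hjk) hkx]
  refine ((le_bPt_iff hρ hj hjx).1 le_rfl).trans ?_
  gcongr

theorem integral_of_two_pieces {J f g : ℝ → ℝ} {b c : ℝ}
    (h0 : ∀ y ≤ b, J y = 0) (h1 : ∀ y, b < y → y ≤ c → J y = f y) (h2 : ∀ y, c < y → J y = g y)
    (hbc : b ≤ c) (hf : IntegrableOn f (Set.Ioc b c)) (hg : IntegrableOn g (Set.Ioi c)) :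
    ∫ y, J y = (∫ y in Set.Ioc b c, f y) + ∫ y in Set.Ioi c, g y := by
  have e : J = fun y => (Set.Ioc b c).indicator f y + (Set.Ioi c).indicator g y := by
    funext y
    rcases le_or_gt y b with h | h
    · simp [h0 y h, Set.indicator, h.not_gt, (h.trans hbc).not_gt]
    rcases le_or_gt y c with h' | h'
    · simp [h1 y h h', Set.indicator, h, h', h'.not_gt]
    · simp [h2 y h', Set.indicator, h', h'.not_ge]
  rw [e, integral_add ((integrable_indicator_iff measurableSet_Ioc).2 hf)
    ((integrable_indicator_iff measurableSet_Ioi).2 hg), integral_indicator measurableSet_Ioc,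
    integral_indicator measurableSet_Ioi]

theorem integral_of_one_piece {J g : ℝ → ℝ} {b : ℝ}
    (h0 : ∀ y ≤ b, J y = 0) (h1 : ∀ y, b < y → J y = g y) :
    ∫ y, J y = ∫ y in Set.Ioi b, g y := by
  rw [← integral_indicator measurableSet_Ioi]
  congr 1
  funext y
  rcases le_or_gt y b with h | h
  · simp [h0 y h, Set.indicator, h.not_gt]
  · simp [h1 y h, Set.indicator, h]

/-! ### The closed-form terms as incomplete gamma values -/

/-- The closed form of the integral of the threshold term over `Ioi b`. -/
noncomputable def thresholdGamma (n : ℕ) (a x b : ℝ) (i l : ℕ) : ℝ :=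
  ∑ v ∈ Finset.range (l + 1), (l.choose v : ℝ) * a ^ (l - v) * upperGamma (n - i + v) (x + 1) b

theorem D1_eq {n i : ℕ} (hi : i ≤ n) (ρ x : ℝ) (k l : ℕ) :
    D1 (n + 2) ρ x k i l =
      thresholdGamma n ((n + 2 : ℕ) / ρ) x (bPt (n + 2) ρ x (k - 1)) i l -
        thresholdGamma n ((n + 2 : ℕ) / ρ) x (bPt (n + 2) ρ x k) i l := by
  unfold D1 thresholdGamma
  rw [← Finset.sum_sub_distrib]
  refine Finset.sum_congr rfl fun v _ => ?_
  rw [upperGamma, upperGamma, show n + 2 - i + v - 2 = n - i + v by omega,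
    show n + 2 - i + v - 1 = n - i + v + 1 by omega]
  simp only [Finset.mul_sum, ← Finset.sum_sub_distrib]
  refine Finset.sum_congr rfl fun u _ => ?_
  ring

theorem F1_eq {n i : ℕ} (hi : i ≤ n) (ρ x : ℝ) (m l : ℕ) :
    F1 (n + 2) ρ x m i l =
      thresholdGamma n ((n + 2 : ℕ) / ρ) x (bPt (n + 2) ρ x (m - 1)) i l := by
  unfold F1 thresholdGamma upperGamma
  refine Finset.sum_congr rfl fun v _ => ?_
  rw [show n + 2 - i + v - 2 = n - i + v by omega,
    show n + 2 - i + v - 1 = n - i + v + 1 by omega]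
  ring

theorem D2_eq {n i : ℕ} (hi : i ≤ n) (ρ x : ℝ) (k l : ℕ) :
    D2 (n + 2) ρ x k i l =
      upperGamma (n - i + l) (k / ((k : ℝ) - 1)) (bPt (n + 2) ρ x (k - 1)) -
        upperGamma (n - i + l) (k / ((k : ℝ) - 1)) (bPt (n + 2) ρ x k) := by
  unfold D2 upperGamma
  rw [show n + 2 - i + l - 2 = n - i + l by omega,
    show n + 2 - i + l - 1 = n - i + l + 1 by omega]
  ring

theorem E1_eq {n i : ℕ} (hi : i ≤ n) (ρ x : ℝ) (k l : ℕ) :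
    E1 (n + 2) ρ x k i l =
      upperGamma (n - i + l) (((k : ℝ) + 1) / k) (bPt (n + 2) ρ x k) := by
  unfold E1 upperGamma
  rw [show n + 2 - i + l - 2 = n - i + l by omega,
    show n + 2 - i + l - 1 = n - i + l + 1 by omega]

theorem E2_eq {n i : ℕ} (hi : i ≤ n) (ρ x : ℝ) (k l : ℕ) :
    E2 (n + 2) ρ x k i l =
      upperGamma (n - i + l) (k / ((k : ℝ) - 1)) (bPt (n + 2) ρ x k) := by
  unfold E2 upperGamma
  rw [show n + 2 - i + l - 2 = n - i + l by omega,
    show n + 2 - i + l - 1 = n - i + l + 1 by omega]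

theorem F2_eq {n i : ℕ} (hi : i ≤ n) (ρ x : ℝ) (m l : ℕ) :
    F2 (n + 2) ρ x m i l =
      upperGamma (n - i + l) (m / ((m : ℝ) - 1)) (bPt (n + 2) ρ x (m - 1)) := by
  unfold F2 upperGamma
  rw [show n + 2 - i + l - 2 = n - i + l by omega,
    show n + 2 - i + l - 1 = n - i + l + 1 by omega]

/-- Only `t = 1` occurs, and `(1 - t)^i = 0^i` leaves only `i = 0`. -/
theorem xi_one (n : ℕ) (f : ℕ → ℕ → ℝ) :
    xi (n + 2) 1 f = ((n + 2 : ℕ) : ℝ) / (n.factorial : ℝ) * f 0 0 := by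
  unfold xi
  rw [Finset.Icc_self, Finset.sum_singleton, Finset.sum_eq_single 0]
  · simp
  · intro i _ hi
    simp [hi]
  · simp

theorem C1_eq (n : ℕ) (ρ x : ℝ) :
    C1 (n + 2) ρ x = upperGamma n (x + 1) 0 - upperGamma n (x + 1) (bPt (n + 2) ρ x 1) := by
  have h0 : upperGamma n (x + 1) 0 = (n.factorial : ℝ) / (x + 1) ^ (n + 1) := by
    unfold upperGamma
    rw [Finset.sum_eq_single 0]
    · simp
    · intro u _ hu
      simp [hu]
    · simp
  rw [h0]
  unfold C1 upperGamma
  simp only [Nat.add_sub_cancel, show n + 2 - 1 = n + 1 by omega, mul_div_assoc]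
  ring

theorem C2_eq (n : ℕ) (ρ x : ℝ) :
    C2 (n + 2) ρ x = upperGamma n 2 (bPt (n + 2) ρ x 1) := by
  unfold C2 upperGamma
  simp only [Nat.add_sub_cancel, show n + 2 - 1 = n + 1 by omega, mul_div_assoc]

/-- The `(i, l)` term of the integrand in `y` coming from the `z`-endpoint `x * (a + y)`. -/
noncomputable def thresholdTerm (n : ℕ) (a x y : ℝ) (i l : ℕ) : ℝ :=
  Real.exp (-y) * y ^ (n - i) *
    (Real.exp (-(x * (a + y))) * ((x * (a + y)) ^ l / (l.factorial : ℝ)))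

/-- The `(i, l)` term of the integrand in `y` coming from the `z`-endpoint `y / κ`. -/
noncomputable def ratioTerm (n : ℕ) (κ y : ℝ) (i l : ℕ) : ℝ :=
  Real.exp (-y) * y ^ (n - i) * (Real.exp (-(y / κ)) * ((y / κ) ^ l / (l.factorial : ℝ)))

/-- The closed form of the integral of the ratio term over `Ioi b`. -/
noncomputable def ratioGamma (n : ℕ) (κ b : ℝ) (i l : ℕ) : ℝ :=
  1 / (κ ^ l * (l.factorial : ℝ)) * upperGamma (n - i + l) ((κ + 1) / κ) b

theorem integrableOn_thresholdTerm (n : ℕ) {a x b : ℝ} (hx : 0 < x) (hb : 0 ≤ b) (i l : ℕ) :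
    IntegrableOn (fun y => thresholdTerm n a x y i l) (Set.Ioi b) :=
  integrableOn_threshold_term (n - i) l hx hb

theorem integrableOn_ratioTerm (n : ℕ) {κ b : ℝ} (hκ : 0 < κ) (hb : 0 ≤ b) (i l : ℕ) :
    IntegrableOn (fun y => ratioTerm n κ y i l) (Set.Ioi b) :=
  integrableOn_ratio_term (n - i) l hκ hb

theorem integral_Ioi_thresholdTerm (n : ℕ) {a x b : ℝ} (hx : 0 < x) (hb : 0 ≤ b) (i l : ℕ) :
    ∫ y in Set.Ioi b, thresholdTerm n a x y i l =
      Real.exp (-(x * a)) * (x ^ l / (l.factorial : ℝ)) * thresholdGamma n a x b i l :=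
  integral_Ioi_threshold_term (n - i) l hx hb

theorem integral_Ioi_ratioTerm (n : ℕ) {κ b : ℝ} (hκ : 0 < κ) (hb : 0 ≤ b) (i l : ℕ) :
    ∫ y in Set.Ioi b, ratioTerm n κ y i l = ratioGamma n κ b i l :=
  integral_Ioi_ratio_term (n - i) l hκ hb

theorem integral_Ioc_thresholdTerm (n : ℕ) {a x b c : ℝ} (hx : 0 < x) (hb : 0 ≤ b) (hbc : b ≤ c)
    (i l : ℕ) :
    ∫ y in Set.Ioc b c, thresholdTerm n a x y i l =
      Real.exp (-(x * a)) * (x ^ l / (l.factorial : ℝ)) *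
        (thresholdGamma n a x b i l - thresholdGamma n a x c i l) := by
  rw [setIntegral_Ioc_eq_sub hbc (integrableOn_thresholdTerm n hx hb i l),
    integral_Ioi_thresholdTerm n hx hb, integral_Ioi_thresholdTerm n hx (hb.trans hbc), mul_sub]

theorem integral_Ioc_ratioTerm (n : ℕ) {κ b c : ℝ} (hκ : 0 < κ) (hb : 0 ≤ b) (hbc : b ≤ c)
    (i l : ℕ) :
    ∫ y in Set.Ioc b c, ratioTerm n κ y i l = ratioGamma n κ b i l - ratioGamma n κ c i l := by
  rw [setIntegral_Ioc_eq_sub hbc (integrableOn_ratioTerm n hκ hb i l),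
    integral_Ioi_ratioTerm n hκ hb, integral_Ioi_ratioTerm n hκ (hb.trans hbc)]

/-! ### Integrating each wedge over `y` -/

/-- In the first wedge `z` is unbounded above. Its lower end is the threshold up to `b_1`, giving
`C1`, and `y` itself beyond, giving `C2`. -/
theorem integral_wedgeSlice_one (n : ℕ) {ρ x : ℝ} (hρ : 0 < ρ) (hx : 0 < x) (hx1 : x < 1) :
    ((n + 2 : ℕ) : ℝ) * ∫ y, wedgeSlice n ((n + 2 : ℕ) / ρ) x 1 y = covFirst (n + 2) ρ x := by
  set a : ℝ := (n + 2 : ℕ) / ρ with ha_def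
  have ha : 0 < a := by positivity
  have hkx : ((1 : ℕ) : ℝ) * x < 1 := by simpa using hx1
  have hb := bPt_pos (N := n + 2) (by omega) hρ hx le_rfl hkx
  have hle := fun y => le_bPt_iff (N := n + 2) (y := y) hρ le_rfl hkx
  set b := bPt (n + 2) ρ x 1 with hb_def
  rw [← integral_const_mul, integral_of_two_pieces (b := 0) (c := b)
    (f := fun y => xi (n + 2) 1 (thresholdTerm n a x y))
    (g := fun y => xi (n + 2) 1 (ratioTerm n 1 y))]
  · rw [integral_xi fun i _ l _ =>
        (integrableOn_thresholdTerm n hx le_rfl i l).mono_set Set.Ioc_subset_Ioi_self,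
      integral_xi fun i _ l _ => integrableOn_ratioTerm n one_pos hb.le i l, xi_one, xi_one,
      integral_Ioc_thresholdTerm n hx le_rfl hb.le, integral_Ioi_ratioTerm n one_pos hb.le,
      covFirst, C1_eq, C2_eq, ← hb_def, thresholdGamma, thresholdGamma, ratioGamma,
      Nat.add_sub_cancel, mul_div_assoc x, ← ha_def]
    -- The rate `(κ + 1)/κ` at `κ = 1` is the `2` in `C2`.
    simp [one_add_one_eq_two]
    ring
  · intro y hy
    rw [wedgeSlice_of_nonpos n a x 1 hy, mul_zero]
  · intro y hy hyb
    have h := (hle y).1 hyb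
    rw [Nat.cast_one, one_mul] at h
    rw [wedgeSlice_one_of_le n ha hx hy h, integral_Ioi_wedgeDensity n 1 y (by positivity)]
    rfl
  · intro y hyb
    have h := not_le.1 (mt (hle y).2 hyb.not_ge)
    rw [Nat.cast_one, one_mul] at h
    have hy := hb.trans hyb
    rw [wedgeSlice_one_of_lt n hy h, integral_Ioi_wedgeDensity n 1 y (by positivity)]
    rfl
  · exact hb.le
  · exact integrableOn_xi fun i _ l _ =>
      (integrableOn_thresholdTerm n hx le_rfl i l).mono_set Set.Ioc_subset_Ioi_self
  · exact integrableOn_xi fun i _ l _ => integrableOn_ratioTerm n one_pos hb.le i l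

theorem natCast_pred {k : ℕ} (hk : 1 ≤ k) : ((k - 1 : ℕ) : ℝ) = (k : ℝ) - 1 := by
  push_cast [hk]
  ring

/-- The slice is empty up to `b_{k-1}`. The lower end of `z` is the threshold on `(b_{k-1}, b_k]`
(`D1`, `D2`) and `y/k` beyond (`E1`, `E2`). The upper end `y/(k-1)` accounts for the rate `k/(k-1)`.
-/
theorem integral_wedgeSlice_mid (n : ℕ) {ρ x : ℝ} (hρ : 0 < ρ) (hx : 0 < x) {k : ℕ} (hk : 2 ≤ k)
    (hkx : k * x < 1) :
    ((n + 2 : ℕ) : ℝ) * ∫ y, wedgeSlice n ((n + 2 : ℕ) / ρ) x k y = covMid (n + 2) ρ x k := by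
  set a : ℝ := (n + 2 : ℕ) / ρ with ha_def
  have ha : 0 < a := by positivity
  have hk2 : (2 : ℝ) ≤ k := by exact_mod_cast hk
  have hκ : 0 < (k : ℝ) - 1 := by linarith
  have hk0 : 0 < (k : ℝ) := by linarith
  have hpred := natCast_pred (show 1 ≤ k by omega)
  have hjx : ((k - 1 : ℕ) : ℝ) * x < 1 := by rw [hpred]; nlinarith
  have hb := bPt_pos (N := n + 2) (by omega) hρ hx (show 1 ≤ k - 1 by omega) hjx
  have hbc := bPt_mono (N := n + 2) (by omega) hρ hx (show 1 ≤ k - 1 by omega)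
    (Nat.sub_le k 1) hkx
  have hleb := fun y => le_bPt_iff (N := n + 2) (y := y) hρ (show 1 ≤ k - 1 by omega) hjx
  have hlec := fun y => le_bPt_iff (N := n + 2) (y := y) hρ (show 1 ≤ k by omega) hkx
  rw [hpred] at hleb
  set b := bPt (n + 2) ρ x (k - 1) with hb_def
  set c := bPt (n + 2) ρ x k with hc_def
  have hc := hb.trans_le hbc
  have hT := fun i l => (integrableOn_thresholdTerm n (a := a) hx hb.le i l).mono_set
    (Set.Ioc_subset_Ioi_self : Set.Ioc b c ⊆ Set.Ioi b)
  have hR := fun i l => (integrableOn_ratioTerm n hκ hb.le i l).mono_set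
    (Set.Ioc_subset_Ioi_self : Set.Ioc b c ⊆ Set.Ioi b)
  have hTR : ∀ i l, IntegrableOn
      (fun y => thresholdTerm n a x y i l - ratioTerm n ((k : ℝ) - 1) y i l) (Set.Ioc b c) :=
    fun i l => (hT i l).sub (hR i l)
  have hRk := fun i l => integrableOn_ratioTerm n hk0 hc.le i l
  have hRκ := fun i l => integrableOn_ratioTerm n hκ hc.le i l
  have hRR : ∀ i l, IntegrableOn
      (fun y => ratioTerm n k y i l - ratioTerm n ((k : ℝ) - 1) y i l) (Set.Ioi c) :=
    fun i l => (hRk i l).sub (hRκ i l)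
  rw [← integral_const_mul, integral_of_two_pieces (b := b) (c := c)
    (f := fun y => xi (n + 2) k fun i l =>
      thresholdTerm n a x y i l - ratioTerm n ((k : ℝ) - 1) y i l)
    (g := fun y => xi (n + 2) k fun i l =>
      ratioTerm n k y i l - ratioTerm n ((k : ℝ) - 1) y i l)]
  · rw [integral_xi fun i _ l _ => hTR i l,
      integral_xi fun i _ l _ => hRR i l, covMid]
    congr 1
    · refine xi_congr fun i hi l _ => ?_
      have hi' : i ≤ n := by omega
      rw [integral_sub (hT i l) (hR i l), integral_Ioc_thresholdTerm n hx hb.le hbc,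
        integral_Ioc_ratioTerm n hκ hb.le hbc, D1_eq hi', D2_eq hi', mul_div_assoc x, ← ha_def,
        ratioGamma, ratioGamma, sub_add_cancel, ← mul_sub]
    · refine xi_congr fun i hi l _ => ?_
      have hi' : i ≤ n := by omega
      rw [integral_sub (hRk i l) (hRκ i l), integral_Ioi_ratioTerm n hk0 hc.le,
        integral_Ioi_ratioTerm n hκ hc.le, E1_eq hi', E2_eq hi', ratioGamma, ratioGamma,
        sub_add_cancel]
  · intro y hy
    rw [wedgeSlice_eq_zero n hk ((hleb y).1 hy), mul_zero]
  · intro y hby hyc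
    have h1 := not_le.1 (mt (hleb y).2 hby.not_ge)
    have hy := hb.trans hby
    rw [wedgeSlice_of_le n ha hx hy hk ((hlec y).1 hyc),
      integral_Ioc_wedgeDensity n k y (by positivity)]
    · rfl
    · rw [le_div_iff₀ hκ]
      linarith
  · intro y hcy
    have h1 := not_le.1 (mt (hlec y).2 hcy.not_ge)
    have hy := hc.trans hcy
    rw [wedgeSlice_of_lt n hy hk h1, integral_Ioc_wedgeDensity n k y (by positivity)]
    · rfl
    · gcongr
      linarith
  · exact hbc
  · exact integrableOn_xi fun i _ l _ => hTR i l
  · exact integrableOn_xi fun i _ l _ => hRR i l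

/-- Since `m x ≥ 1`, the threshold stays above `y/m` for every `y > 0`: there is no breakpoint
`b_m`, and a single piece remains. -/
theorem integral_wedgeSlice_last (n : ℕ) {ρ x : ℝ} (hρ : 0 < ρ) (hx : 0 < x) {m : ℕ} (hm : 2 ≤ m)
    (hmx : ((m : ℝ) - 1) * x < 1) (hmx' : 1 ≤ m * x) :
    ((n + 2 : ℕ) : ℝ) * ∫ y, wedgeSlice n ((n + 2 : ℕ) / ρ) x m y = covLast (n + 2) ρ x m := by
  set a : ℝ := (n + 2 : ℕ) / ρ with ha_def
  have ha : 0 < a := by positivity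
  have hm2 : (2 : ℝ) ≤ m := by exact_mod_cast hm
  have hκ : 0 < (m : ℝ) - 1 := by linarith
  have hpred := natCast_pred (show 1 ≤ m by omega)
  have hjx : ((m - 1 : ℕ) : ℝ) * x < 1 := by rw [hpred]; exact hmx
  have hb := bPt_pos (N := n + 2) (by omega) hρ hx (show 1 ≤ m - 1 by omega) hjx
  have hleb := fun y => le_bPt_iff (N := n + 2) (y := y) hρ (show 1 ≤ m - 1 by omega) hjx
  rw [hpred] at hleb
  set b := bPt (n + 2) ρ x (m - 1) with hb_def
  have hT := fun i l => integrableOn_thresholdTerm n (a := a) hx hb.le i l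
  have hR := fun i l => integrableOn_ratioTerm n hκ hb.le i l
  have hTR : ∀ i l, IntegrableOn
      (fun y => thresholdTerm n a x y i l - ratioTerm n ((m : ℝ) - 1) y i l) (Set.Ioi b) :=
    fun i l => (hT i l).sub (hR i l)
  rw [← integral_const_mul, integral_of_one_piece (b := b)
    (g := fun y => xi (n + 2) m fun i l =>
      thresholdTerm n a x y i l - ratioTerm n ((m : ℝ) - 1) y i l)]
  · rw [integral_xi fun i _ l _ => hTR i l, covLast]
    refine xi_congr fun i hi l _ => ?_
    have hi' : i ≤ n := by omega
    rw [integral_sub (hT i l) (hR i l), integral_Ioi_thresholdTerm n hx hb.le,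
      integral_Ioi_ratioTerm n hκ hb.le, F1_eq hi', F2_eq hi', mul_div_assoc x, ← ha_def,
      ratioGamma, sub_add_cancel]
  · intro y hy
    rw [wedgeSlice_eq_zero n hm ((hleb y).1 hy), mul_zero]
  · intro y hby
    have h1 := not_le.1 (mt (hleb y).2 hby.not_ge)
    have hy := hb.trans hby
    have h2 : y ≤ m * (x * (a + y)) := by
      have : 0 ≤ (m * x) * a := by positivity
      nlinarith [mul_nonneg hy.le (sub_nonneg.2 hmx')]
    rw [wedgeSlice_of_le n ha hx hy hm h2, integral_Ioc_wedgeDensity n m y (by positivity)]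
    · rfl
    · rw [le_div_iff₀ hκ]
      linarith

theorem integral_excessDensity_eq (n : ℕ) {ρ x : ℝ} (hρ : 0 < ρ) (hx : 0 < x) (hx1 : x < 1) :
    ((n + 2 : ℕ) : ℝ) * ∫ p, excessDensity n ((n + 2 : ℕ) / ρ) x p =
      covFirst (n + 2) ρ x + ∑ k ∈ Finset.Icc 2 (⌈1 / x⌉₊ - 1), covMid (n + 2) ρ x k +
        covLast (n + 2) ρ x ⌈1 / x⌉₊ := by
  have h1 := Nat.le_ceil (1 / x)
  have h2 := Nat.ceil_lt_add_one (one_div_pos.2 hx).le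
  have hm : 2 ≤ ⌈1 / x⌉₊ := Nat.lt_ceil.2 (by rw [Nat.cast_one, lt_div_iff₀ hx]; linarith)
  set m := ⌈1 / x⌉₊
  rw [div_le_iff₀ hx] at h1
  rw [← sub_lt_iff_lt_add, lt_div_iff₀ hx] at h2
  rw [integral_excessDensity n (by positivity) hx h1, Finset.mul_sum,
    ← Finset.add_sum_Ioc_eq_sum_Icc (show 1 ≤ m by omega), integral_wedgeSlice_one n hρ hx hx1,
    ← Finset.Icc_add_one_left_eq_Ioc, add_assoc]
  congr 1
  -- This form splits off the top wedge even when `m = 2` and the middle range is empty.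
  obtain ⟨k, hk⟩ : ∃ k, m = k + 2 := ⟨m - 2, by omega⟩
  rw [hk, Finset.sum_Icc_succ_top (by omega), ← hk, integral_wedgeSlice_last n hρ hx hm h2 h1,
    show m - 1 = k + 1 by omega]
  congr 1
  refine Finset.sum_congr rfl fun j hj => ?_
  obtain ⟨hj1, hj2⟩ := Finset.mem_Icc.1 hj
  refine integral_wedgeSlice_mid n hρ hx hj1 (lt_of_le_of_lt ?_ h2)
  have : (j : ℝ) ≤ (m : ℝ) - 1 := by
    rw [hk]
    push_cast
    have : (j : ℝ) ≤ k + 1 := by exact_mod_cast hj2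
    linarith
  gcongr

/-! ### The distribution function of the maximum -/

theorem cdf_maxSINR {Ω : Type*} [MeasurableSpace Ω] {μ : Measure Ω} [IsProbabilityMeasure μ]
    {Nt N : ℕ} (hN : 1 ≤ N) {PT σ2 : ℝ} (hPT : 0 < PT) (hσ2 : 0 < σ2)
    {h : Ω → Fin Nt → ℂ} {P : Ω → Matrix (Fin Nt) (Fin N) ℂ}
    (hgain : AEMeasurable (fun ω n => beamGain (h ω) (P ω) n) μ)
    (hmax : AEMeasurable (fun ω => maxSINR PT σ2 (h ω) (P ω)) μ)
    (hlaw : μ.map (fun ω n => beamGain (h ω) (P ω) n) =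
      Measure.pi fun _ : Fin N => expMeasure 1) (x : ℝ) :
    cdf (μ.map (fun ω => maxSINR PT σ2 (h ω) (P ω))) x =
      1 - (Measure.pi fun _ : Fin N => expMeasure 1).real
        {g | ∃ n, Exceeds (N / (PT / σ2)) x g n} := by
  have : IsProbabilityMeasure (μ.map (fun ω => maxSINR PT σ2 (h ω) (P ω))) :=
    Measure.isProbabilityMeasure_map hmax
  have hE : MeasurableSet {g : Fin N → ℝ | ∃ n, Exceeds (N / (PT / σ2)) x g n} := by
    have : {g : Fin N → ℝ | ∃ n, Exceeds (N / (PT / σ2)) x g n} =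
        ⋃ n, {g | Exceeds (N / (PT / σ2)) x g n} := by
      ext g
      simp
    rw [this]
    exact MeasurableSet.iUnion fun n => measurableSet_exceeds _ x n
  rw [cdf_eq_real, ← probReal_compl_eq_one_sub hE, ← hlaw, map_measureReal_apply_of_aemeasurable
    hmax measurableSet_Iic, map_measureReal_apply_of_aemeasurable hgain hE.compl]
  congr 1
  ext ω
  exact maxSINR_le_iff hN hPT hσ2 (h ω) (P ω) x

end ORP

theorem corollary1 {Ω : Type*} [MeasurableSpace Ω] (μ : Measure Ω) [IsProbabilityMeasure μ]
    (Nt N : ℕ) (hN : 1 ≤ N) (hNt : N ≤ Nt)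
    (PT σ2 ρ : ℝ) (hPT : 0 < PT) (hσ2 : 0 < σ2) (hρ : ρ = PT / σ2)
    -- Rayleigh fading: the channel coefficients are i.i.d. `CN(0, 1)`
    (h : Ω → Fin Nt → ℂ)
    (h_law : ∀ j, HasLaw (fun ω => h ω j) (ORP.complexGaussian 1) μ)
    (h_indep : iIndepFun (fun j ω => h ω j) μ)
    -- the random precoder: orthonormal columns, generated independently of the channel
    (P : Ω → Matrix (Fin Nt) (Fin N) ℂ)
    (P_meas : ∀ j n, AEMeasurable (fun ω => P ω j n) μ)
    (P_orth : ∀ᵐ ω ∂μ, (P ω).conjTranspose * P ω = 1)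
    (hP_indep : IndepFun h (fun ω j n => P ω j n) μ) :
    AEMeasurable (fun ω => ORP.maxSINR PT σ2 (h ω) (P ω)) μ ∧
    (∀ x : ℝ, 1 ≤ x →
      cdf (μ.map (fun ω => ORP.maxSINR PT σ2 (h ω) (P ω))) x =
        1 - (N : ℝ) / (x + 1) ^ (N - 1) * Real.exp (-(x * N / ρ))) ∧
    (2 ≤ N → ∀ x : ℝ, 0 < x → x < 1 → ∀ m : ℕ, m = ⌈1 / x⌉₊ →
      cdf (μ.map (fun ω => ORP.maxSINR PT σ2 (h ω) (P ω))) x =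
        1 - (ORP.covFirst N ρ x + ∑ k ∈ Finset.Icc 2 (m - 1), ORP.covMid N ρ x k +
          ORP.covLast N ρ x m)) := by
  have hh : AEMeasurable h μ := aemeasurable_pi_lambda _ fun j => (h_law j).aemeasurable
  have hgain := ORP.aemeasurable_gains hh P_meas
  have hlaw := ORP.map_gains h_law h_indep P_meas P_orth hP_indep
  have hmax : AEMeasurable (fun ω => ORP.maxSINR PT σ2 (h ω) (P ω)) μ :=
    (ORP.measurable_maxSINR_gains PT σ2).comp_aemeasurable hgain
  have hρ0 : 0 < ρ := hρ ▸ div_pos hPT hσ2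
  have hcdf := ORP.cdf_maxSINR hN hPT hσ2 hgain hmax hlaw
  rw [← hρ] at hcdf
  refine ⟨hmax, fun x hx => ?_, fun hN2 x hx hx1 m hm => ?_⟩
  · obtain ⟨n, rfl⟩ : ∃ n, N = n + 1 := ⟨N - 1, by omega⟩
    rw [hcdf, ORP.pi_exists_exceeds_of_one_le n (by positivity) hx, Nat.add_sub_cancel,
      mul_div_assoc x]
  · obtain ⟨n, rfl⟩ : ∃ n, N = n + 2 := ⟨N - 2, by omega⟩
    rw [hcdf, ORP.pi_exists_exceeds n hx.le, ORP.integral_excessDensity_eq n hρ0 hx hx1, hm]
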